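/- Let $H$ be a finite-dimensional Hopf algebra over $\mathbb{C}$ with antipode $S$, let $A := H^*$ be the dual Hopf algebra (convolution product $(fg)(x)=\sum f(x_1)g(x_2)$, comultiplication dual to the multiplication of $H$, antipode the transpose of $S$, again denoted $S$), let $\mathrm{Rad}(H)$ be the Jacobson radical of $H$, and let $\mathrm{Corad}(A)$ be the coradical of $A$, i.e. the sum of all simple subcoalgebras of $A$. Then $S(\mathrm{Rad}(H))\subseteq \mathrm{Rad}(H)$, so that $S$ induces a linear map on $H/\mathrm{Rad}(H)$, and the following conditions are equivalent: 1. $H$ has the Chevalley property: the tensor product over $\mathbb{C}$ of any two simple left $H$-modules (with $H$ acting through its comultiplication) is a semisimple $H$-module. 2. The category of right $A$-comodules has the Chevalley property: the tensor product of any two simple right $A$-comodules is a semisimple comodule. 3. $\mathrm{Corad}(A)$ is a Hopf subalgebra of $A$. 4. $\mathrm{Rad}(H)$ is a Hopf ideal of $H$, and thus $H/\mathrm{Rad}(H)$ is a Hopf algebra, the projection $H\to H/\mathrm{Rad}(H)$ being a homomorphism of Hopf algebras. 5. $S^2=\mathrm{Id}$ on $H/\mathrm{Rad}(H)$. 6.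 $S^2=\mathrm{Id}$ on $\mathrm{Corad}(A)$. -/

import Mathlib

open scoped TensorProduct

universe u v w

noncomputable section

namespace HopfChevalley

/-! ## The dual Hopf algebra -/

section Dual

variable (k : Type v) (H : Type u) [Field k] [Ring H]

/-- The dual space `H* = Hom_k(H, k)` of a Hopf algebra. It carries Mathlib's convolution product
`(f * g)(x) = ∑ f(x₁) g(x₂)`, whose unit is the counit of `H`; `DualHopf.equiv` identifies it with
`H →ₗ[k] k` as a vector space. -/
def DualHopf [Algebra k H] : Type (max u v) := WithConv (H →ₗ[k] k)

variable [HopfAlgebra k H]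

instance instRingDual : Ring (DualHopf k H) := inferInstanceAs (Ring (WithConv (H →ₗ[k] k)))

instance instAlgebraDual : Algebra k (DualHopf k H) :=
  inferInstanceAs (Algebra k (WithConv (H →ₗ[k] k)))

/-- An element of `H*`, regarded as a linear form on `H`. -/
def DualHopf.equiv : DualHopf k H ≃ₗ[k] (H →ₗ[k] k) where
  toFun f := WithConv.ofConv f
  invFun f := WithConv.toConv f
  map_add' _ _ := rfl
  map_smul' _ _ := rfl
  left_inv _ := rfl
  right_inv _ := rfl

instance instCoeFunDual : CoeFun (DualHopf k H) (fun _ => H → k) where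
  coe f := DualHopf.equiv k H f

variable {k H} in
@[ext] theorem DualHopf.ext {f g : DualHopf k H} (h : ∀ x, f x = g x) : f = g :=
  (DualHopf.equiv k H).injective (LinearMap.ext h)

variable {k H} in
theorem DualHopf.equiv_mul (f g : DualHopf k H) : DualHopf.equiv k H (f * g) =
    (WithConv.toConv (DualHopf.equiv k H f) * WithConv.toConv (DualHopf.equiv k H g)).ofConv := rfl

variable {k H} in
theorem DualHopf.mul_apply (f g : DualHopf k H) (x : H) :
    (f * g) x = LinearMap.mul' k k (TensorProduct.map (DualHopf.equiv k H f) (DualHopf.equiv k H g)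
      (Coalgebra.comul x)) := rfl

variable {k H} in
@[simp] theorem DualHopf.one_apply (x : H) : (1 : DualHopf k H) x = Coalgebra.counit x := rfl

variable {k H} in
theorem DualHopf.mul_apply_repr {ι : Type*} (f g : DualHopf k H) {x : H}
    (r : Coalgebra.Repr k x ι) : (f * g) x = ∑ i ∈ r.index, f (r.left i) * g (r.right i) := by
  rw [DualHopf.mul_apply, ← r.eq]
  simp

/-- The pairing `H* ⊗ H* → (H ⊗ H)*`, `⟨f ⊗ g, x ⊗ y⟩ = f(x) g(y)`. -/
def pair₂ : DualHopf k H ⊗[k] DualHopf k H →ₗ[k] (H ⊗[k] H →ₗ[k] k) :=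
  TensorProduct.dualDistrib k H H ∘ₗ
    TensorProduct.map (DualHopf.equiv k H).toLinearMap (DualHopf.equiv k H).toLinearMap

variable {k H}

@[simp] theorem pair₂_tmul (f g : DualHopf k H) (x y : H) :
    pair₂ k H (f ⊗ₜ g) (x ⊗ₜ y) = f x * g y := rfl

variable (k H) in
/-- In finite dimension the pairing identifies `H* ⊗ H*` with `(H ⊗ H)*`. -/
def pairEquiv [FiniteDimensional k H] :
    (DualHopf k H ⊗[k] DualHopf k H) ≃ₗ[k] (H ⊗[k] H →ₗ[k] k) :=
  TensorProduct.congr (DualHopf.equiv k H) (DualHopf.equiv k H) ≪≫ₗ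
    TensorProduct.dualDistribEquiv k H H

theorem pair₂_injective [FiniteDimensional k H] : Function.Injective (pair₂ k H) :=
  (pairEquiv k H).injective

/-- The comultiplication of `H*`, dual to the multiplication of `H`: `⟨Δ f, x ⊗ y⟩ = f(x y)`. -/
def dualComul [FiniteDimensional k H] : DualHopf k H →ₗ[k] DualHopf k H ⊗[k] DualHopf k H :=
  (pairEquiv k H).symm.toLinearMap ∘ₗ LinearMap.lcomp k k (LinearMap.mul' k H) ∘ₗ
    (DualHopf.equiv k H).toLinearMap

theorem pair₂_dualComul' [FiniteDimensional k H] (f : DualHopf k H) :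
    pair₂ k H (dualComul f) = DualHopf.equiv k H f ∘ₗ LinearMap.mul' k H :=
  (pairEquiv k H).apply_symm_apply _

@[simp] theorem pair₂_dualComul [FiniteDimensional k H] (f : DualHopf k H) (x y : H) :
    pair₂ k H (dualComul f) (x ⊗ₜ y) = f (x * y) := by
  rw [pair₂_dualComul']; rfl

/-- The counit of `H*`: evaluation at `1`. -/
def dualCounit : DualHopf k H →ₗ[k] k :=
  LinearMap.applyₗ (1 : H) ∘ₗ (DualHopf.equiv k H).toLinearMap

@[simp] theorem dualCounit_apply (f : DualHopf k H) : dualCounit f = f 1 := rfl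

/-- The antipode of `H*`: the transpose of the antipode of `H`. -/
def dualAntipode : DualHopf k H →ₗ[k] DualHopf k H :=
  (DualHopf.equiv k H).symm.toLinearMap ∘ₗ
    LinearMap.lcomp k k (HopfAlgebra.antipode k (A := H)) ∘ₗ (DualHopf.equiv k H).toLinearMap

@[simp] theorem dualAntipode_apply (f : DualHopf k H) (x : H) :
    dualAntipode f x = f (HopfAlgebra.antipode k x) := rfl

variable (k H) in
/-- The pairing `H* ⊗ (H* ⊗ H*) → (H ⊗ (H ⊗ H))*`. -/
def pair₃ : DualHopf k H ⊗[k] (DualHopf k H ⊗[k] DualHopf k H) →ₗ[k]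
    (H ⊗[k] (H ⊗[k] H) →ₗ[k] k) :=
  TensorProduct.dualDistrib k H (H ⊗[k] H) ∘ₗ
    TensorProduct.map (DualHopf.equiv k H).toLinearMap (pair₂ k H)

@[simp] theorem pair₃_tmul (f : DualHopf k H) (t : DualHopf k H ⊗[k] DualHopf k H) (x : H)
    (z : H ⊗[k] H) : pair₃ k H (f ⊗ₜ t) (x ⊗ₜ z) = f x * pair₂ k H t z := rfl

theorem pair₃_injective [FiniteDimensional k H] : Function.Injective (pair₃ k H) :=
  (TensorProduct.congr (DualHopf.equiv k H) (pairEquiv k H) ≪≫ₗ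
    TensorProduct.dualDistribEquiv k H (H ⊗[k] H)).injective

theorem pair₃_assoc (s : DualHopf k H ⊗[k] DualHopf k H) (g : DualHopf k H) (x y z : H) :
    pair₃ k H (TensorProduct.assoc k _ _ _ (s ⊗ₜ g)) (x ⊗ₜ (y ⊗ₜ z)) =
      pair₂ k H s (x ⊗ₜ y) * g z := by
  induction s with
  | zero => simp
  | tmul a b => simp [mul_assoc]
  | add a b ha hb => simp only [TensorProduct.add_tmul, map_add, LinearMap.add_apply, ha, hb,
      add_mul]

theorem pair₃_left [FiniteDimensional k H] (t : DualHopf k H ⊗[k] DualHopf k H) (x y z : H) :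
    pair₃ k H (TensorProduct.assoc k _ _ _ (dualComul.rTensor _ t)) (x ⊗ₜ (y ⊗ₜ z)) =
      pair₂ k H t ((x * y) ⊗ₜ z) := by
  induction t with
  | zero => simp
  | tmul a b => simp [pair₃_assoc]
  | add a b ha hb => simp only [map_add, LinearMap.add_apply, ha, hb]

theorem pair₃_right [FiniteDimensional k H] (t : DualHopf k H ⊗[k] DualHopf k H) (x y z : H) :
    pair₃ k H (dualComul.lTensor _ t) (x ⊗ₜ (y ⊗ₜ z)) = pair₂ k H t (x ⊗ₜ (y * z)) := by
  induction t with
  | zero => simp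
  | tmul a b => simp
  | add a b ha hb => simp only [map_add, LinearMap.add_apply, ha, hb]

theorem dualCounit_left (t : DualHopf k H ⊗[k] DualHopf k H) (x : H) :
    (TensorProduct.lid k _ (dualCounit.rTensor _ t)) x = pair₂ k H t (1 ⊗ₜ x) := by
  induction t with
  | zero => simp
  | tmul a b => simp
  | add a b ha hb => simp only [map_add, LinearMap.add_apply, ha, hb]

theorem dualCounit_right (t : DualHopf k H ⊗[k] DualHopf k H) (x : H) :
    (TensorProduct.rid k _ (dualCounit.lTensor _ t)) x = pair₂ k H t (x ⊗ₜ 1) := by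
  induction t with
  | zero => simp
  | tmul a b => simp [mul_comm]
  | add a b ha hb => simp only [map_add, LinearMap.add_apply, ha, hb]

/-- The pairing sends products in `H* ⊗ H*` to convolution products. -/
theorem pair₂_mul (s t : DualHopf k H ⊗[k] DualHopf k H) :
    pair₂ k H (s * t) =
      (WithConv.toConv (pair₂ k H s) * WithConv.toConv (pair₂ k H t)).ofConv := by
  induction s with
  | zero => simp
  | add a b ha hb => simp only [map_add, add_mul, ha, hb, WithConv.toConv_add, WithConv.ofConv_add]
  | tmul a b =>
    induction t with
    | zero => simp
    | add c d hc hd =>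
      simp only [map_add, mul_add, hc, hd, WithConv.toConv_add, WithConv.ofConv_add]
    | tmul c d =>
      refine TensorProduct.ext' fun x y => ?_
      let ℛx := Coalgebra.Repr.arbitrary k x
      let ℛy := Coalgebra.Repr.arbitrary k y
      rw [Algebra.TensorProduct.tmul_mul_tmul, pair₂_tmul, DualHopf.mul_apply_repr _ _ ℛx,
        DualHopf.mul_apply_repr _ _ ℛy, (ℛx.tmul ℛy).convMul_apply]
      simp [Finset.sum_mul_sum, Finset.sum_product, mul_mul_mul_comm]

theorem mul'_rTensor_dual (t : DualHopf k H ⊗[k] DualHopf k H) (x : H) :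
    (LinearMap.mul' k _ (dualAntipode.rTensor _ t)) x =
      pair₂ k H t ((HopfAlgebra.antipode k).rTensor H (Coalgebra.comul x)) := by
  induction t with
  | zero => simp
  | tmul a b =>
    let ℛx := Coalgebra.Repr.arbitrary k x
    rw [LinearMap.rTensor_tmul, LinearMap.mul'_apply, DualHopf.mul_apply_repr _ _ ℛx, ← ℛx.eq]
    simp
  | add a b ha hb => simp only [map_add, LinearMap.add_apply, ha, hb]

theorem mul'_lTensor_dual (t : DualHopf k H ⊗[k] DualHopf k H) (x : H) :
    (LinearMap.mul' k _ (dualAntipode.lTensor _ t)) x =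
      pair₂ k H t ((HopfAlgebra.antipode k).lTensor H (Coalgebra.comul x)) := by
  induction t with
  | zero => simp
  | tmul a b =>
    let ℛx := Coalgebra.Repr.arbitrary k x
    rw [LinearMap.lTensor_tmul, LinearMap.mul'_apply, DualHopf.mul_apply_repr _ _ ℛx, ← ℛx.eq]
    simp
  | add a b ha hb => simp only [map_add, LinearMap.add_apply, ha, hb]

variable [FiniteDimensional k H]

instance instCoalgebraDual : Coalgebra k (DualHopf k H) where
  comul := dualComul
  counit := dualCounit
  coassoc := by
    refine LinearMap.ext fun f => pair₃_injective ?_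
    ext x y z
    simp [pair₃_left, pair₃_right, mul_assoc]
  rTensor_counit_comp_comul := by
    refine LinearMap.ext fun f => (TensorProduct.lid k (DualHopf k H)).injective ?_
    ext x
    simp [dualCounit_left]
  lTensor_counit_comp_comul := by
    refine LinearMap.ext fun f => (TensorProduct.rid k (DualHopf k H)).injective ?_
    ext x
    simp [dualCounit_right]

theorem dual_comul_eq (f : DualHopf k H) : Coalgebra.comul (R := k) f = dualComul f := rfl

theorem dual_counit_eq (f : DualHopf k H) : Coalgebra.counit (R := k) f = f 1 := rfl

instance instBialgebraDual : Bialgebra k (DualHopf k H) :=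
  Bialgebra.mk' k (DualHopf k H)
    (by simp [dual_counit_eq])
    (by intro a b
        simp only [dual_counit_eq]
        rw [DualHopf.mul_apply]
        simp [Algebra.TensorProduct.one_def])
    (by rw [dual_comul_eq]
        apply pair₂_injective
        ext x y
        simp [Algebra.TensorProduct.one_def])
    (by intro a b
        simp only [dual_comul_eq]
        apply pair₂_injective
        rw [pair₂_mul, pair₂_dualComul', pair₂_dualComul', pair₂_dualComul']
        exact LinearMap.convMul_comp_coalgHom_distrib (WithConv.toConv (DualHopf.equiv k H a))
          (WithConv.toConv (DualHopf.equiv k H b)) (Bialgebra.mulCoalgHom k H))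

/-- The dual Hopf algebra `H*` of a finite-dimensional Hopf algebra `H`. -/
instance instHopfAlgebraDual : HopfAlgebra k (DualHopf k H) where
  antipode := dualAntipode
  mul_antipode_rTensor_comul := by
    ext f x
    simp only [LinearMap.comp_apply, dual_comul_eq, mul'_rTensor_dual, pair₂_dualComul',
      HopfAlgebra.mul_antipode_rTensor_comul_apply]
    simp [dual_counit_eq, Algebra.algebraMap_eq_smul_one, mul_comm]
  mul_antipode_lTensor_comul := by
    ext f x
    simp only [LinearMap.comp_apply, dual_comul_eq, mul'_lTensor_dual, pair₂_dualComul',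
      HopfAlgebra.mul_antipode_lTensor_comul_apply]
    simp [dual_counit_eq, Algebra.algebraMap_eq_smul_one, mul_comm]

end Dual

/-! ## Tensor products of modules over a bialgebra, and the Chevalley property -/

section Modules

variable (k : Type v) (H : Type u) [Field k] [Ring H] [Bialgebra k H]

/-- The action of a bialgebra `H` on `V ⊗ W` through the comultiplication:
`h • (v ⊗ w) = ∑ h₁ v ⊗ h₂ w`. -/
def diagonalAction (V W : Type w) [AddCommGroup V] [Module k V] [Module H V] [IsScalarTower k H V]
    [AddCommGroup W] [Module k W] [Module H W] [IsScalarTower k H W] :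
    H →ₐ[k] Module.End k (V ⊗[k] W) :=
  (Module.endTensorEndAlgHom (R := k) (S := k) (A := k) (M := V) (N := W)).comp
    ((Algebra.TensorProduct.map (Algebra.lsmul k k V) (Algebra.lsmul k k W)).comp
      (Bialgebra.comulAlgHom k H))

/-- The `H`-module structure on `V ⊗ W` defined by `diagonalAction`. (It is not an instance, since
Mathlib also has the action of `H` on the left factor alone.) -/
abbrev tensorModule (V W : Type w) [AddCommGroup V] [Module k V] [Module H V] [IsScalarTower k H V]
    [AddCommGroup W] [Module k W] [Module H W] [IsScalarTower k H W] : Module H (V ⊗[k] W) :=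
  Module.compHom (V ⊗[k] W) (diagonalAction k H V W).toRingHom

/-- `H` has the Chevalley property: the tensor product of any two simple left `H`-modules is
semisimple. -/
def HasChevalleyProperty : Prop :=
  ∀ (V W : Type w) [AddCommGroup V] [Module k V] [Module H V] [IsScalarTower k H V]
    [AddCommGroup W] [Module k W] [Module H W] [IsScalarTower k H W],
    IsSimpleModule H V → IsSimpleModule H W →
      @IsSemisimpleModule H _ (V ⊗[k] W) _ (tensorModule k H V W)

end Modules

/-! ## Comodules -/

section Comodules

variable (k : Type v) (A : Type u) [Field k] [Ring A] [Bialgebra k A]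

/-- A right `A`-comodule structure on the vector space `V`. -/
structure RightComodule (V : Type w) [AddCommGroup V] [Module k V] where
  /-- The coaction `ρ : V → V ⊗ A`. -/
  coact : V →ₗ[k] V ⊗[k] A
  /-- `(ρ ⊗ id) ρ = (id ⊗ Δ) ρ`. -/
  coassoc : ∀ v, TensorProduct.assoc k V A A (coact.rTensor A (coact v)) =
    (Coalgebra.comul (R := k) (A := A)).lTensor V (coact v)
  /-- `(id ⊗ ε) ρ = id`. -/
  counit : ∀ v, TensorProduct.rid k V
    ((Coalgebra.counit (R := k) (A := A)).lTensor V (coact v)) = v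

namespace RightComodule

variable {k A} {V W : Type w} [AddCommGroup V] [Module k V] [AddCommGroup W] [Module k W]

/-- A subspace `U` of a comodule is a subcomodule when `ρ(U) ⊆ U ⊗ A`. -/
def IsSubcomodule (M : RightComodule k A V) (U : Submodule k V) : Prop :=
  ∀ u ∈ U, M.coact u ∈ LinearMap.range (U.subtype.rTensor A)

/-- A comodule is simple when it is nonzero and its only subcomodules are `0` and itself. -/
def IsSimple (M : RightComodule k A V) : Prop :=
  Nontrivial V ∧ ∀ U : Submodule k V, M.IsSubcomodule U → U = ⊥ ∨ U = ⊤

/-- A comodule is semisimple when each subcomodule has a complementary subcomodule, equivalently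
when it is a direct sum of simple comodules. -/
def IsSemisimple (M : RightComodule k A V) : Prop :=
  ∀ U : Submodule k V, M.IsSubcomodule U → ∃ U' : Submodule k V, M.IsSubcomodule U' ∧ IsCompl U U'

variable (k A V W) in
/-- `(v ⊗ a) ⊗ (w ⊗ b) ↦ (v ⊗ w) ⊗ a b`. -/
def mulMiddle : (V ⊗[k] A) ⊗[k] (W ⊗[k] A) →ₗ[k] (V ⊗[k] W) ⊗[k] A :=
  (LinearMap.mul' k A).lTensor (V ⊗[k] W) ∘ₗ
    (TensorProduct.tensorTensorTensorComm k V A W A).toLinearMap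

@[simp] theorem mulMiddle_tmul (v : V) (a : A) (w : W) (b : A) :
    mulMiddle k A V W ((v ⊗ₜ a) ⊗ₜ (w ⊗ₜ b)) = (v ⊗ₜ w) ⊗ₜ (a * b) := rfl

/-- The coaction `v ⊗ w ↦ ∑ (v₀ ⊗ w₀) ⊗ v₁ w₁` on `V ⊗ W`. -/
def tensorCoact (M : RightComodule k A V) (N : RightComodule k A W) :
    V ⊗[k] W →ₗ[k] (V ⊗[k] W) ⊗[k] A :=
  mulMiddle k A V W ∘ₗ TensorProduct.map M.coact N.coact

@[simp] theorem tensorCoact_tmul (M : RightComodule k A V) (N : RightComodule k A W) (v : V)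
    (w : W) : tensorCoact M N (v ⊗ₜ w) = mulMiddle k A V W (M.coact v ⊗ₜ N.coact w) := rfl

/-- `(v ⊗ (a ⊗ a')) ⊗ (w ⊗ (b ⊗ b')) ↦ (v ⊗ w) ⊗ (a b ⊗ a' b')`. -/
def mulMiddle₂ : (V ⊗[k] (A ⊗[k] A)) ⊗[k] (W ⊗[k] (A ⊗[k] A)) →ₗ[k]
    (V ⊗[k] W) ⊗[k] (A ⊗[k] A) :=
  (LinearMap.mul' k (A ⊗[k] A)).lTensor (V ⊗[k] W) ∘ₗ
    (TensorProduct.tensorTensorTensorComm k V (A ⊗[k] A) W (A ⊗[k] A)).toLinearMap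

theorem mulMiddle₂_tmul (v : V) (a : A ⊗[k] A) (w : W) (b : A ⊗[k] A) :
    mulMiddle₂ ((v ⊗ₜ a) ⊗ₜ (w ⊗ₜ b)) = (v ⊗ₜ[k] w) ⊗ₜ[k] (a * b) := rfl

theorem assoc_mulMiddle (s : V ⊗[k] A) (a : A) (t : W ⊗[k] A) (b : A) :
    TensorProduct.assoc k _ _ _ (mulMiddle k A V W (s ⊗ₜ t) ⊗ₜ (a * b)) =
      mulMiddle₂ (TensorProduct.assoc k _ _ _ (s ⊗ₜ a) ⊗ₜ TensorProduct.assoc k _ _ _ (t ⊗ₜ b)) := by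
  induction s with
  | zero => simp
  | add s₁ s₂ h₁ h₂ => simp only [TensorProduct.add_tmul, map_add, h₁, h₂]
  | tmul v c =>
    induction t with
    | zero => simp
    | add t₁ t₂ h₁ h₂ => simp only [TensorProduct.add_tmul, TensorProduct.tmul_add, map_add, h₁, h₂]
    | tmul w d => simp [mulMiddle₂_tmul]

theorem tensor_coassoc_left (M : RightComodule k A V) (N : RightComodule k A W)
    (s : V ⊗[k] A) (t : W ⊗[k] A) :
    TensorProduct.assoc k _ _ _ ((tensorCoact M N).rTensor A (mulMiddle k A V W (s ⊗ₜ t))) =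
      mulMiddle₂ (TensorProduct.assoc k _ _ _ (M.coact.rTensor A s) ⊗ₜ
        TensorProduct.assoc k _ _ _ (N.coact.rTensor A t)) := by
  induction s with
  | zero => simp
  | add s₁ s₂ h₁ h₂ => simp only [TensorProduct.add_tmul, map_add, h₁, h₂]
  | tmul v a =>
    induction t with
    | zero => simp
    | add t₁ t₂ h₁ h₂ => simp only [TensorProduct.tmul_add, map_add, h₁, h₂]
    | tmul w b => simp [assoc_mulMiddle]

theorem tensor_coassoc_right (s : V ⊗[k] A) (t : W ⊗[k] A) :
    (Coalgebra.comul (R := k) (A := A)).lTensor (V ⊗[k] W) (mulMiddle k A V W (s ⊗ₜ t)) =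
      mulMiddle₂ ((Coalgebra.comul (R := k) (A := A)).lTensor V s ⊗ₜ
        (Coalgebra.comul (R := k) (A := A)).lTensor W t) := by
  induction s with
  | zero => simp
  | add s₁ s₂ h₁ h₂ => simp only [TensorProduct.add_tmul, map_add, h₁, h₂]
  | tmul v a =>
    induction t with
    | zero => simp
    | add t₁ t₂ h₁ h₂ => simp only [TensorProduct.tmul_add, map_add, h₁, h₂]
    | tmul w b => simp [mulMiddle₂_tmul]

theorem tensor_counit (s : V ⊗[k] A) (t : W ⊗[k] A) :
    TensorProduct.rid k (V ⊗[k] W) ((Coalgebra.counit (R := k) (A := A)).lTensor (V ⊗[k] W)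
        (mulMiddle k A V W (s ⊗ₜ t))) =
      TensorProduct.rid k V ((Coalgebra.counit (R := k) (A := A)).lTensor V s) ⊗ₜ
        TensorProduct.rid k W ((Coalgebra.counit (R := k) (A := A)).lTensor W t) := by
  induction s with
  | zero => simp
  | add s₁ s₂ h₁ h₂ => simp only [TensorProduct.add_tmul, map_add, h₁, h₂]
  | tmul v a =>
    induction t with
    | zero => simp
    | add t₁ t₂ h₁ h₂ => simp only [TensorProduct.tmul_add, map_add, h₁, h₂]
    | tmul w b => simp [TensorProduct.smul_tmul', smul_smul, mul_comm]

/-- The tensor product of two right comodules over a bialgebra. -/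
def tensor (M : RightComodule k A V) (N : RightComodule k A W) : RightComodule k A (V ⊗[k] W) where
  coact := tensorCoact M N
  coassoc x := by
    induction x with
    | zero => simp
    | add x y hx hy => simp only [map_add, hx, hy]
    | tmul v w =>
      rw [tensorCoact_tmul, tensor_coassoc_left, tensor_coassoc_right, M.coassoc, N.coassoc]
  counit x := by
    induction x with
    | zero => simp
    | add x y hx hy => simp only [map_add, hx, hy]
    | tmul v w => rw [tensorCoact_tmul, tensor_counit, M.counit, N.counit]

end RightComodule

/-- The category of right `A`-comodules has the Chevalley property: the tensor product of any two
simple right `A`-comodules is semisimple. -/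
def ComodulesHaveChevalleyProperty : Prop :=
  ∀ (V W : Type w) [AddCommGroup V] [Module k V] [AddCommGroup W] [Module k W]
    (M : RightComodule k A V) (N : RightComodule k A W),
    M.IsSimple → N.IsSimple → (M.tensor N).IsSemisimple

end Comodules

/-! ## The coradical, Hopf subalgebras and quotients by Hopf ideals -/

section Coradical

variable (k : Type v) (C : Type u) [Field k] [AddCommGroup C] [Module k C] [Coalgebra k C]

variable {k C} in
/-- A subspace `D` is a subcoalgebra when `Δ(D) ⊆ D ⊗ D`. -/
def IsSubcoalgebra (D : Submodule k C) : Prop :=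
  ∀ x ∈ D, Coalgebra.comul (R := k) x ∈ LinearMap.range (TensorProduct.map D.subtype D.subtype)

variable {k C} in
/-- A simple subcoalgebra: nonzero, with no subcoalgebras other than `0` and itself. -/
def IsSimpleSubcoalgebra (D : Submodule k C) : Prop :=
  IsSubcoalgebra D ∧ D ≠ ⊥ ∧ ∀ E : Submodule k C, IsSubcoalgebra E → E ≤ D → E = ⊥ ∨ E = D

/-- The coradical of a coalgebra: the sum of its simple subcoalgebras. -/
def corad : Submodule k C := sSup {D : Submodule k C | IsSimpleSubcoalgebra D}

end Coradical

section HopfSub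

variable {k : Type v} {A : Type u} [Field k] [Ring A] [HopfAlgebra k A]

/-- A Hopf subalgebra: a unital subalgebra and subcoalgebra stable under the antipode. -/
structure IsHopfSubalgebra (B : Submodule k A) : Prop where
  one_mem : (1 : A) ∈ B
  mul_mem : ∀ x ∈ B, ∀ y ∈ B, x * y ∈ B
  isSubcoalgebra : IsSubcoalgebra B
  antipode_mem : ∀ x ∈ B, HopfAlgebra.antipode k x ∈ B

variable (k) in
/-- `f` is a homomorphism of Hopf algebras. -/
def IsHopfHom {B : Type u} [Ring B] [HopfAlgebra k B] (f : A → B) : Prop :=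
  ∃ π : A →ₐc[k] B, (∀ x, π x = f x) ∧
    ∀ x, HopfAlgebra.antipode k (π x) = π (HopfAlgebra.antipode k x)

variable (k) in
/-- `A ⧸ I` is a Hopf algebra in such a way that the projection `A → A ⧸ I` is a homomorphism of
Hopf algebras. -/
def QuotientIsHopfAlgebra (I : Ideal A) [I.IsTwoSided] : Prop :=
  ∃ _ : HopfAlgebra k (A ⧸ I), IsHopfHom k (Ideal.Quotient.mk I)

end HopfSub

end HopfChevalley

end

open HopfChevalley

/-! Write J for `Ring.jacobson H` and J^⊥ for the functionals killing J (`radPerp`). Annihilators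
exchange two-sided ideals of H with subcoalgebras of H*, so simple subcoalgebras correspond to
simple quotients of H, and over ℂ this gives Corad(H*) = J^⊥ (`corad_eq_radPerp`). A right
H*-comodule is the same thing as a left H-module, compatibly with tensor products, whence 1 ↔ 2. The
antipode is bijective and antimultiplicative, so it preserves J.

1 → 3: J^⊥ is spanned by matrix coefficients of simple modules, and a product of two coefficients is
a coefficient of the tensor product; J kills that tensor product when it is semisimple. 3 → 4:
common zeros of a Hopf subalgebra form a Hopf ideal. 4 → 1: if Δ(J) ⊆ J ⊗ H + H ⊗ J, then J kills
every tensor product of two simple modules. 5 ↔ 6 is duality.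

The deep part is the Larson–Radford theory. 4 → 5 needs that S² = 1 on a semisimple complex Hopf
algebra. The form l(x) = Tr(L_x S²) is an integral whose Nakayama automorphism is S². Radford's
argument makes S⁴ conjugation by a grouplike element, so S² has finite order; on the Wedderburn
blocks S² is then conjugation by some u, and Tr S² = ∑ tr(u_i) tr(u_i⁻¹) is a sum of nonnegative
terms that is not zero (`trace_antipodeSq_ne_zero`). Nonvanishing of Tr S² trivialises the grouplike
element, so S⁴ = 1; an integrality argument with the regular character of H* leaves only S² = ±1,
and S²(1) = 1 decides the sign.

6 → 4 uses the converse `jacobson_eq_bot_of_antipode_antipode`: in characteristic 0, S² = 1 forces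
semisimplicity. Since J^⊥ is not yet known to be closed under products, one passes to the algebra B
that it generates. This is a Hopf subalgebra on which S² = 1, so H modulo the common zeros I of B is
semisimple and J ⊆ I, while J^⊥ ⊆ B gives I ⊆ J. -/

noncomputable section

namespace HopfChevalley

open Coalgebra HopfAlgebra

/-! ### Convolution identities for the antipode, and the actions of H* on H -/

section Sweedler

variable {k : Type v} {H : Type u} [Field k] [Ring H] [HopfAlgebra k H]

variable (k H) in
/-- `x ↦ x ⊗ 1`, as an element of the convolution algebra. -/
def convInl : WithConv (H →ₗ[k] H ⊗[k] H) :=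
  WithConv.toConv
    (Algebra.TensorProduct.includeLeft (R := k) (S := k) (A := H) (B := H)).toLinearMap

variable (k H) in
/-- `x ↦ 1 ⊗ x`, as an element of the convolution algebra. -/
def convInr : WithConv (H →ₗ[k] H ⊗[k] H) :=
  WithConv.toConv (Algebra.TensorProduct.includeRight (R := k) (A := H) (B := H)).toLinearMap

/-- Precomposition with the antipode. -/
def convAnti {M : Type*} [AddCommGroup M] [Module k M] (F : WithConv (H →ₗ[k] M)) :
    WithConv (H →ₗ[k] M) :=
  WithConv.toConv (F.ofConv ∘ₗ antipode k (A := H))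

variable (k H) in
/-- The comultiplication, as an element of the convolution algebra. -/
def convComul : WithConv (H →ₗ[k] H ⊗[k] H) := WithConv.toConv comul

theorem convInl_apply (x : H) : convInl k H x = x ⊗ₜ 1 := rfl
theorem convInr_apply (x : H) : convInr k H x = 1 ⊗ₜ x := rfl
theorem convComul_apply (x : H) : convComul k H x = comul x := rfl
theorem convAnti_apply {M : Type*} [AddCommGroup M] [Module k M] (F : WithConv (H →ₗ[k] M))
    (x : H) :
    convAnti F x = F (antipode k x) := rfl

theorem algHom_mul_convAnti {R : Type*} [Ring R] [Algebra k R] (φ : H →ₐ[k] R) :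
    WithConv.toConv φ.toLinearMap * convAnti (WithConv.toConv φ.toLinearMap) = 1 := by
  ext x
  rw [(ℛ k x).convMul_apply]
  have := congrArg φ (sum_mul_antipode_eq_algebraMap_counit (ℛ k x))
  simpa [convAnti_apply] using this

theorem convAnti_mul_algHom {R : Type*} [Ring R] [Algebra k R] (φ : H →ₐ[k] R) :
    convAnti (WithConv.toConv φ.toLinearMap) * WithConv.toConv φ.toLinearMap = 1 := by
  ext x
  rw [(ℛ k x).convMul_apply]
  have := congrArg φ (sum_antipode_mul_eq_algebraMap_counit (ℛ k x))
  simpa [convAnti_apply] using this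

theorem convInl_mul_convAnti : convInl k H * convAnti (convInl k H) = 1 := algHom_mul_convAnti _
theorem convAnti_mul_convInl : convAnti (convInl k H) * convInl k H = 1 := convAnti_mul_algHom _
theorem convInr_mul_convAnti : convInr k H * convAnti (convInr k H) = 1 := algHom_mul_convAnti _
theorem convAnti_mul_convComul : convAnti (convComul k H) * convComul k H = 1 :=
  convAnti_mul_algHom (Bialgebra.comulAlgHom k H)

theorem convInl_mul_convInr : convInl k H * convInr k H = convComul k H := by
  ext x
  rw [(ℛ k x).convMul_apply, convComul_apply, ← (ℛ k x).eq]
  simp [convInl_apply, convInr_apply]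

/-- Both sides are convolution inverses of Δ = (x ↦ x ⊗ 1) * (x ↦ 1 ⊗ x), one on the left and one on
the right, so they agree. -/
theorem convAnti_convComul :
    convAnti (convComul k H) = convAnti (convInr k H) * convAnti (convInl k H) := by
  refine left_inv_eq_right_inv convAnti_mul_convComul ?_
  rw [← convInl_mul_convInr, mul_assoc, ← mul_assoc (convInr k H), convInr_mul_convAnti, one_mul,
    convInl_mul_convAnti]

variable {ι : Type*}

/-- `Δ(S x) = ∑ S x₂ ⊗ S x₁`. -/
theorem comul_antipode {x : H} (r : Coalgebra.Repr k x ι) :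
    comul (R := k) (antipode k x) =
      ∑ i ∈ r.index, antipode k (r.right i) ⊗ₜ[k] antipode k (r.left i) := by
  have := congrArg (fun F : WithConv (H →ₗ[k] H ⊗[k] H) => F x)
    (convAnti_convComul (k := k) (H := H))
  simp only [r.convMul_apply] at this
  simpa [convAnti_apply, convInl_apply, convInr_apply, convComul_apply] using this

/-- `∑ (S x₁ ⊗ 1) Δ(x₂) = 1 ⊗ x`. -/
theorem sum_antipode_tmul_one_mul_comul {x : H} (r : Coalgebra.Repr k x ι) :
    ∑ i ∈ r.index, (antipode k (r.left i) ⊗ₜ[k] (1 : H)) * comul (R := k) (r.right i) =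
      1 ⊗ₜ x := by
  have : convAnti (convInl k H) * convComul k H = convInr k H := by
    rw [← convInl_mul_convInr, ← mul_assoc, convAnti_mul_convInl, one_mul]
  have := congrArg (fun F : WithConv (H →ₗ[k] H ⊗[k] H) => F x) this
  simp only [r.convMul_apply] at this
  exact this

/-- `∑ Δ(x₁) (1 ⊗ S x₂) = x ⊗ 1`. -/
theorem sum_comul_mul_one_tmul_antipode {x : H} (r : Coalgebra.Repr k x ι) :
    ∑ i ∈ r.index, comul (R := k) (r.left i) * ((1 : H) ⊗ₜ[k] antipode k (r.right i)) =
      x ⊗ₜ 1 := by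
  have : convComul k H * convAnti (convInr k H) = convInl k H := by
    rw [← convInl_mul_convInr, mul_assoc, convInr_mul_convAnti, mul_one]
  have := congrArg (fun F : WithConv (H →ₗ[k] H ⊗[k] H) => F x) this
  simp only [r.convMul_apply] at this
  exact this

/-- `∑ Δ(S x₁) (x₂ ⊗ 1) = 1 ⊗ S x`. -/
theorem sum_comul_antipode_mul_tmul_one {x : H} (r : Coalgebra.Repr k x ι) :
    ∑ i ∈ r.index, comul (R := k) (antipode k (r.left i)) * (r.right i ⊗ₜ[k] (1 : H)) =
      1 ⊗ₜ antipode k x := by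
  have : convAnti (convComul k H) * convInl k H = convAnti (convInr k H) := by
    rw [convAnti_convComul, mul_assoc, convAnti_mul_convInl, mul_one]
  have := congrArg (fun F : WithConv (H →ₗ[k] H ⊗[k] H) => F x) this
  simp only [r.convMul_apply] at this
  exact this

/-- `∑ Δ(S² x₂) (S x₁ ⊗ 1) = 1 ⊗ S² x`. -/
theorem sum_comul_antipode_antipode_mul {x : H} (r : Coalgebra.Repr k x ι) :
    ∑ i ∈ r.index, comul (R := k) (antipode k (antipode k (r.right i))) *
      (antipode k (r.left i) ⊗ₜ[k] (1 : H)) = 1 ⊗ₜ antipode k (antipode k x) :=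
  sum_comul_antipode_mul_tmul_one (x := antipode k x)
    ⟨r.index, fun i => antipode k (r.right i), fun i => antipode k (r.left i),
      (comul_antipode r).symm⟩

/-- `h ↦ ∑ h₁ f(h₂)`. -/
def hitR (f : DualHopf k H) : Module.End k H :=
  (TensorProduct.rid k H).toLinearMap ∘ₗ (DualHopf.equiv k H f).lTensor H ∘ₗ comul

/-- `h ↦ ∑ f(h₁) h₂`. -/
def hitL (f : DualHopf k H) : Module.End k H :=
  (TensorProduct.lid k H).toLinearMap ∘ₗ (DualHopf.equiv k H f).rTensor H ∘ₗ comul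

theorem hitR_repr (f : DualHopf k H) {x : H} (r : Coalgebra.Repr k x ι) :
    hitR f x = ∑ i ∈ r.index, f (r.right i) • r.left i := by
  simp [hitR, ← r.eq]

theorem hitL_repr (f : DualHopf k H) {x : H} (r : Coalgebra.Repr k x ι) :
    hitL f x = ∑ i ∈ r.index, f (r.left i) • r.right i := by
  simp [hitL, ← r.eq]

theorem apply_hitR (f g : DualHopf k H) (x : H) : f (hitR g x) = (f * g) x := by
  rw [hitR_repr g (ℛ k x), DualHopf.mul_apply_repr f g (ℛ k x)]
  simp [mul_comm]

theorem apply_hitL (f g : DualHopf k H) (x : H) : f (hitL g x) = (g * f) x := by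
  rw [hitL_repr g (ℛ k x), DualHopf.mul_apply_repr g f (ℛ k x)]
  simp

theorem ext_of_forall_dual {x y : H} (h : ∀ f : DualHopf k H, f x = f y) : x = y := by
  rw [← sub_eq_zero, ← Module.forall_dual_apply_eq_zero_iff k]
  intro φ
  have := h ((DualHopf.equiv k H).symm φ)
  simpa [sub_eq_zero] using this

theorem hitR_mul (f g : DualHopf k H) : hitR (f * g) = hitR f * hitR g := by
  ext x
  refine ext_of_forall_dual (k := k) fun φ => ?_
  simp [apply_hitR, mul_assoc]

theorem hitL_mul (f g : DualHopf k H) : hitL (f * g) = hitL g * hitL f := by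
  ext x
  refine ext_of_forall_dual (k := k) fun φ => ?_
  simp [apply_hitL, mul_assoc]

theorem hitR_one : hitR (1 : DualHopf k H) = 1 := by
  ext x
  refine ext_of_forall_dual (k := k) fun φ => ?_
  simp [apply_hitR]

theorem hitL_one : hitL (1 : DualHopf k H) = 1 := by
  ext x
  refine ext_of_forall_dual (k := k) fun φ => ?_
  simp [apply_hitL]

theorem hitR_hitL_comm (f g : DualHopf k H) : hitR f * hitL g = hitL g * hitR f := by
  ext x
  refine ext_of_forall_dual (k := k) fun φ => ?_
  simp [apply_hitL, apply_hitR, mul_assoc]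

theorem hitR_add (f g : DualHopf k H) : hitR (f + g) = hitR f + hitR g := by
  ext x
  simp [hitR, LinearMap.lTensor_add]

theorem hitR_smul (c : k) (f : DualHopf k H) : hitR (c • f) = c • hitR f := by
  ext x
  simp [hitR]

end Sweedler

/-! ### Integrals on H from traces twisted by S² -/

section Integrals

variable {k : Type v} {H : Type u} [Field k] [Ring H] [HopfAlgebra k H]

variable (k H) in
/-- The square of the antipode. -/
def antipodeSq : Module.End k H := antipode k ∘ₗ antipode k

@[simp] theorem antipodeSq_apply (x : H) : antipodeSq k H x = antipode k (antipode k x) := rfl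

/-- The functional `x ↦ f(x c)`. -/
def dualMulRight (f : DualHopf k H) (c : H) : DualHopf k H :=
  (DualHopf.equiv k H).symm (DualHopf.equiv k H f ∘ₗ LinearMap.mulRight k c)

@[simp] theorem dualMulRight_apply (f : DualHopf k H) (c x : H) :
    dualMulRight f c x = f (x * c) := rfl

theorem lid_rTensor_mul_tmul_one (f : DualHopf k H) (t : H ⊗[k] H) (c : H) :
    TensorProduct.lid k H ((DualHopf.equiv k H f).rTensor H (t * c ⊗ₜ 1)) =
      TensorProduct.lid k H ((DualHopf.equiv k H (dualMulRight f c)).rTensor H t) := by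
  induction t with
  | zero => simp
  | tmul a b => simp
  | add a b ha hb => simp only [add_mul, map_add, ha, hb]

theorem lid_rTensor_mul_one_tmul (f : DualHopf k H) (t : H ⊗[k] H) (c : H) :
    TensorProduct.lid k H ((DualHopf.equiv k H f).rTensor H (t * 1 ⊗ₜ c)) =
      TensorProduct.lid k H ((DualHopf.equiv k H f).rTensor H t) * c := by
  induction t with
  | zero => simp
  | tmul a b => simp
  | add a b ha hb => simp only [add_mul, map_add, ha, hb]

theorem rid_lTensor_mul_tmul_one (f : DualHopf k H) (t : H ⊗[k] H) (c : H) :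
    TensorProduct.rid k H ((DualHopf.equiv k H f).lTensor H (t * c ⊗ₜ 1)) =
      TensorProduct.rid k H ((DualHopf.equiv k H f).lTensor H t) * c := by
  induction t with
  | zero => simp
  | tmul a b => simp
  | add a b ha hb => simp only [add_mul, map_add, ha, hb]

theorem rid_lTensor_tmul_one_mul (f : DualHopf k H) (t : H ⊗[k] H) (c : H) :
    TensorProduct.rid k H ((DualHopf.equiv k H f).lTensor H (c ⊗ₜ 1 * t)) =
      c * TensorProduct.rid k H ((DualHopf.equiv k H f).lTensor H t) := by
  induction t with
  | zero => simp
  | tmul a b => simp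
  | add a b ha hb => simp only [mul_add, map_add, ha, hb]

theorem rid_lTensor_mul_one_tmul (f : DualHopf k H) (t : H ⊗[k] H) (c : H) :
    TensorProduct.rid k H ((DualHopf.equiv k H f).lTensor H (t * 1 ⊗ₜ c)) =
      TensorProduct.rid k H ((DualHopf.equiv k H (dualMulRight f c)).lTensor H t) := by
  induction t with
  | zero => simp
  | tmul a b => simp
  | add a b ha hb => simp only [add_mul, map_add, ha, hb]

theorem sum_basis_apply_mul {ι : Type*} [Fintype ι] (b : Module.Basis ι k H) (f : DualHopf k H)
    (x y : H) : ∑ i, f (x * b i) * b.coord i y = f (x * y) := by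
  conv_rhs => rw [← b.sum_repr y]
  simp only [Finset.mul_sum, mul_smul_comm, map_sum, map_smul, smul_eq_mul,
    Module.Basis.coord_apply,
    mul_comm]

theorem dualMulRight_eq_sum {ι : Type*} [Fintype ι] (b : Module.Basis ι k H) (f : DualHopf k H)
    (y : H) : dualMulRight f y = ∑ i, b.coord i y • dualMulRight f (b i) := by
  ext x
  rw [dualMulRight_apply, ← sum_basis_apply_mul b]
  simp [mul_comm]

theorem sum_mul_dualAntipode {ι : Type*} [Fintype ι] (b : Module.Basis ι k H) (f : DualHopf k H) :
    ∑ i, dualMulRight f (b i) * dualAntipode ((DualHopf.equiv k H).symm (b.coord i)) =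
      f 1 • (1 : DualHopf k H) := by
  ext y
  have h1 : ∀ i, (dualMulRight f (b i) * dualAntipode ((DualHopf.equiv k H).symm (b.coord i))) y =
      ∑ j ∈ (ℛ k y).index, f ((ℛ k y).left j * b i) * b.coord i (antipode k ((ℛ k y).right j)) :=
    fun i => DualHopf.mul_apply_repr _ _ (ℛ k y)
  simp only [map_sum, LinearMap.sum_apply, h1]
  rw [Finset.sum_comm]
  simp only [sum_basis_apply_mul]
  rw [← map_sum, sum_mul_antipode_eq_algebraMap_counit]
  simp [Algebra.algebraMap_eq_smul_one, mul_comm]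

/-- Multiply Δ(x) by 1 ⊗ S²(h) = ∑ Δ(S² h₂)(S h₁ ⊗ 1) and apply f ⊗ id. Expanding S h₁ in the basis
separates the two occurrences of h, leaving operators that cyclicity of the trace can move around.
-/
theorem sum_smul_mul_antipodeSq {ι κ : Type*} [Fintype ι] (b : Module.Basis ι k H)
    (f : DualHopf k H)
    {x : H} (r : Coalgebra.Repr k x κ) :
    ∑ j ∈ r.index, f (r.left j) • (LinearMap.mulLeft k (r.right j) * antipodeSq k H) =
      ∑ i, hitL (dualMulRight f (b i)) * (LinearMap.mulLeft k x * antipodeSq k H *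
        hitL (dualAntipode ((DualHopf.equiv k H).symm (b.coord i)))) := by
  ext h
  have h1 : TensorProduct.lid k H ((DualHopf.equiv k H f).rTensor H
      (comul x * 1 ⊗ₜ[k] antipode k (antipode k h))) =
      ∑ j ∈ r.index, f (r.left j) • (r.right j * antipode k (antipode k h)) := by
    rw [lid_rTensor_mul_one_tmul, ← r.eq]
    simp [Finset.sum_mul]
  rw [← sum_comul_antipode_antipode_mul (ℛ k h), Finset.mul_sum] at h1
  simp only [← mul_assoc, ← Bialgebra.comul_mul, map_sum, lid_rTensor_mul_tmul_one] at h1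
  have h2 : ∀ z c : H, TensorProduct.lid k H
      ((DualHopf.equiv k H (dualMulRight f c)).rTensor H (comul z)) =
        ∑ i, b.coord i c • hitL (dualMulRight f (b i)) z := by
    intro z c
    rw [dualMulRight_eq_sum b]
    have : ∀ (g : ι → DualHopf k H) (t : H ⊗[k] H), TensorProduct.lid k H
        ((DualHopf.equiv k H (∑ i, g i)).rTensor H t) =
          ∑ i, TensorProduct.lid k H ((DualHopf.equiv k H (g i)).rTensor H t) := by
      intro g t
      induction t with
      | zero => simp
      | tmul a b => simp [Finset.sum_smul]
      | add a b ha hb => simp only [map_add, ha, hb, Finset.sum_add_distrib]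
    rw [this]
    simp [hitL, LinearMap.rTensor_smul]
  simp only [h2] at h1
  simp only [LinearMap.sum_apply, LinearMap.smul_apply, Module.End.mul_apply,
    LinearMap.mulLeft_apply, antipodeSq_apply]
  rw [← h1, Finset.sum_comm]
  refine Finset.sum_congr rfl fun i _ => ?_
  rw [hitL_repr _ (ℛ k h)]
  simp only [map_sum, map_smul, mul_smul_comm, Finset.mul_sum]
  rfl

/-- The functional `x ↦ Tr(h ↦ ∑ (x S²(h))₁ g((x S²(h))₂))`. -/
def traceForm (g : DualHopf k H) : DualHopf k H :=
  (DualHopf.equiv k H).symm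
    { toFun x := LinearMap.trace k H (hitR g * (LinearMap.mulLeft k x * antipodeSq k H))
      map_add' x y := by
        rw [← map_add, ← mul_add, ← add_mul]; congr; ext; simp [add_mul]
      map_smul' c x := by
        rw [RingHom.id_apply, ← map_smul, ← mul_smul_comm, ← smul_mul_assoc]; congr; ext; simp }

theorem traceForm_apply (g : DualHopf k H) (x : H) : traceForm g x =
    LinearMap.trace k H (hitR g * (LinearMap.mulLeft k x * antipodeSq k H)) := rfl

/-- A left integral on `H`: `∑ x₁ l(x₂) = l(x) 1`. -/
def IsLeftIntegralForm (l : DualHopf k H) : Prop := ∀ f : DualHopf k H, f * l = f 1 • l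

variable [FiniteDimensional k H]

/-- By cyclicity, the two outer `hitL` operators of `sum_smul_mul_antipodeSq` meet. Since `hitL`
reverses products and commutes with `hitR g`, they combine to `hitL` of ∑ f(· bᵢ) * (bⁱ ∘ S), which
is f(1) times the counit. -/
theorem isLeftIntegralForm_traceForm (g : DualHopf k H) : IsLeftIntegralForm (traceForm g) := by
  intro f
  ext x
  let b := Module.finBasis k H
  rw [DualHopf.mul_apply_repr _ _ (ℛ k x)]
  have h1 : ∑ j ∈ (ℛ k x).index, f ((ℛ k x).left j) * traceForm g ((ℛ k x).right j) =
      LinearMap.trace k H (hitR g * ∑ j ∈ (ℛ k x).index, f ((ℛ k x).left j) •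
        (LinearMap.mulLeft k ((ℛ k x).right j) * antipodeSq k H)) := by
    simp [traceForm_apply, Finset.mul_sum]
  rw [h1, sum_smul_mul_antipodeSq b, Finset.mul_sum, map_sum]
  have h2 : ∀ A B X : Module.End k H, LinearMap.trace k H (hitR g * (A * (X * B))) =
      LinearMap.trace k H (B * (hitR g * A) * X) := by
    intro A B X
    rw [← mul_assoc, ← mul_assoc, LinearMap.trace_mul_comm, mul_assoc B]
  simp only [h2]
  simp only [← mul_assoc, ← hitR_hitL_comm]
  simp only [mul_assoc (hitR g) (hitL _) (hitL _), ← hitL_mul]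
  have h3 := congrArg hitL (sum_mul_dualAntipode b f)
  have h4 : ∀ F : Fin (Module.finrank k H) → DualHopf k H, hitL (∑ i, F i) = ∑ i, hitL (F i) := by
    intro F
    ext y
    refine ext_of_forall_dual (k := k) fun φ => ?_
    simp [apply_hitL, Finset.sum_mul]
  rw [← map_sum, ← Finset.sum_mul, ← Finset.sum_mul, ← Finset.mul_sum, ← h4, sum_mul_dualAntipode]
  have h5 : hitL (f 1 • (1 : DualHopf k H)) = f 1 • 1 := by
    rw [← hitL_one]; ext y; simp [hitL]
  rw [h5]
  simp [traceForm_apply, mul_assoc]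

end Integrals

/-! ### Existence of a nonzero integral; the antipode is bijective and preserves the radical -/

section Bijective

variable {k : Type v} {H : Type u} [Field k] [Ring H] [HopfAlgebra k H]

theorem sum_antipode_mul_antipodeSq_hitR {ι : Type*} [Fintype ι] (b : Module.Basis ι k H) (h : H) :
    ∑ i, antipode k (b i) * antipode k (antipode k
      (hitR ((DualHopf.equiv k H).symm (b.coord i)) h)) = algebraMap k H (counit h) := by
  have h1 : ∀ i, hitR ((DualHopf.equiv k H).symm (b.coord i)) h =
      ∑ j ∈ (ℛ k h).index, b.coord i ((ℛ k h).right j) • (ℛ k h).left j := fun i =>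
    hitR_repr _ (ℛ k h)
  simp only [h1, map_sum, map_smul, Finset.mul_sum, mul_smul_comm]
  rw [Finset.sum_comm]
  have h2 : ∀ y z : H, ∑ i, b.coord i y • (antipode k (b i) * z) = antipode k y * z := by
    intro y z
    conv_rhs => rw [← b.sum_repr y]
    simp only [map_sum, map_smul, Finset.sum_mul, smul_mul_assoc, Module.Basis.coord_apply]
  simp only [h2]
  simp only [← antipode_mul_antidistrib]
  rw [← map_sum, sum_antipode_mul_eq_algebraMap_counit]
  simp [Algebra.algebraMap_eq_smul_one]

theorem IsLeftIntegralForm.hitR_eq {l : DualHopf k H} (hl : IsLeftIntegralForm l) (x : H) :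
    hitR l x = l x • 1 :=
  ext_of_forall_dual (k := k) fun f => by
    rw [apply_hitR, hl f]; simp [mul_comm]

/-- `∑ x₁ l(x₂ S y) = ∑ l(x S y₁) y₂` for a left integral `l`. -/
theorem IsLeftIntegralForm.hitR_dualMulRight {l : DualHopf k H} (hl : IsLeftIntegralForm l)
    (x : H) {ι : Type*} {y : H} (r : Coalgebra.Repr k y ι) :
    hitR (dualMulRight l (antipode k y)) x =
      ∑ i ∈ r.index, l (x * antipode k (r.left i)) • r.right i := by
  have : hitR (dualMulRight l (antipode k y)) x = TensorProduct.rid k H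
      ((DualHopf.equiv k H l).lTensor H (comul x * 1 ⊗ₜ[k] antipode k y)) := by
    rw [rid_lTensor_mul_one_tmul]; rfl
  rw [this, ← sum_comul_antipode_mul_tmul_one r, Finset.mul_sum]
  simp only [← mul_assoc, ← Bialgebra.comul_mul, map_sum, rid_lTensor_mul_tmul_one]
  refine Finset.sum_congr rfl fun i _ => ?_
  have := hl.hitR_eq (x * antipode k (r.left i))
  rw [show TensorProduct.rid k H ((DualHopf.equiv k H l).lTensor H
    (comul (x * antipode k (r.left i)))) = hitR l (x * antipode k (r.left i)) from rfl, this]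
  simp

variable [FiniteDimensional k H]

/-- After a cyclic permutation, the operators L_{x S(bᵢ)} S² `hitR`(bⁱ) add up to the rank-one map h
↦ ε(h) x, so the trace is ε applied to `hitR g x`. Every g is thus recovered from trace forms, which
therefore cannot all vanish. -/
theorem sum_traceForm (g : DualHopf k H) (x : H) :
    ∑ i, traceForm ((DualHopf.equiv k H).symm ((Module.finBasis k H).coord i) * g)
      (x * antipode k (Module.finBasis k H i)) = g x := by
  set b := Module.finBasis k H
  have h1 : ∀ i, traceForm ((DualHopf.equiv k H).symm (b.coord i) * g) (x * antipode k (b i)) =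
      LinearMap.trace k H (hitR g * (LinearMap.mulLeft k (x * antipode k (b i)) * antipodeSq k H *
        hitR ((DualHopf.equiv k H).symm (b.coord i)))) := by
    intro i
    rw [traceForm_apply, hitR_mul, mul_assoc (hitR _) (hitR g), LinearMap.trace_mul_comm, mul_assoc]
  simp only [h1]
  rw [← map_sum, ← Finset.mul_sum]
  have h2 : ∑ i, LinearMap.mulLeft k (x * antipode k (b i)) * antipodeSq k H *
        hitR ((DualHopf.equiv k H).symm (b.coord i)) =
      LinearMap.smulRight (counit (R := k) (A := H)) x := by
    ext h
    have := congrArg (x * ·) (sum_antipode_mul_antipodeSq_hitR b h)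
    simpa [Finset.mul_sum, mul_assoc, Algebra.algebraMap_eq_smul_one] using this
  have h3 : hitR g * LinearMap.smulRight (counit (R := k) (A := H)) x =
      LinearMap.smulRight (counit (R := k) (A := H)) (hitR g x) := by
    ext h; simp
  rw [h2, h3, LinearMap.trace_smulRight]
  exact (apply_hitR 1 g x).trans (by rw [one_mul])

variable (k H) in
theorem exists_isLeftIntegralForm : ∃ l : DualHopf k H, IsLeftIntegralForm l ∧ ∃ x, l x ≠ 0 := by
  by_contra! hc
  have := sum_traceForm (1 : DualHopf k H) 1
  simp [hc _ (isLeftIntegralForm_traceForm _)] at this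

-- If S y = 0, the integral identity gives ∑ l(z S y₁) y₂ = 0 for every z, that is, ν_z * f vanishes
-- at y for ν_z = l(z S(·)) and every f. A suitable combination of products ν_z * bⁱ equals l(x)
-- times the unit of H*, so l(x) f(y) = 0, where l(x) ≠ 0.
variable (k H) in
theorem antipode_injective : Function.Injective (antipode k (A := H)) := by
  obtain ⟨l, hl, x, hx⟩ := exists_isLeftIntegralForm k H
  rw [injective_iff_map_eq_zero]
  intro y hy
  refine ext_of_forall_dual (k := k) fun f => ?_
  rw [map_zero]
  let b := Module.finBasis k H
  let ν : H → DualHopf k H := fun z => dualAntipode ((DualHopf.equiv k H).symm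
    (DualHopf.equiv k H l ∘ₗ LinearMap.mulLeft k z))
  have hν : ∀ z w, ν z w = l (z * antipode k w) := fun _ _ => rfl
  have h1 : ∀ z, hitL (ν z) y = 0 := by
    intro z
    have h := hl.hitR_dualMulRight z (ℛ k y)
    rw [hitL_repr _ (ℛ k y)]
    simp only [hν]
    rw [← h, hy]
    have : dualMulRight l (0 : H) = 0 := by ext w; simp
    rw [this]
    simp [hitR]
  -- At w the left side is ∑ l(x S²(w₂) S(w₁)) = ∑ l(x S(w₁ S w₂)) = ε(w) l(x).
  have h2 : ∑ i, ν (x * antipode k (antipode k (b i))) *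
      (DualHopf.equiv k H).symm (b.coord i) = l x • 1 := by
    ext w
    have h3 : ∀ i, (ν (x * antipode k (antipode k (b i))) *
        (DualHopf.equiv k H).symm (b.coord i)) w = ∑ j ∈ (ℛ k w).index,
          l (x * antipode k (antipode k (b i)) * antipode k ((ℛ k w).left j)) *
            b.coord i ((ℛ k w).right j) := fun i => DualHopf.mul_apply_repr _ _ (ℛ k w)
    simp only [map_sum, LinearMap.sum_apply, h3]
    rw [Finset.sum_comm]
    have h4 : ∀ u v : H, ∑ i, l (x * antipode k (antipode k (b i)) * antipode k u) * b.coord i v =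
        l (x * antipode k (u * antipode k v)) := by
      intro u v
      conv_rhs => rw [← b.sum_repr v]
      simp only [map_sum, map_smul, Finset.mul_sum, mul_smul_comm, smul_eq_mul,
        Module.Basis.coord_apply, antipode_mul_antidistrib, mul_assoc]
      exact Finset.sum_congr rfl fun i _ => mul_comm _ _
    simp only [h4]
    rw [← map_sum, ← Finset.mul_sum, ← map_sum, sum_mul_antipode_eq_algebraMap_counit]
    simp [Algebra.algebraMap_eq_smul_one, mul_comm]
  have h5 : ((∑ i, ν (x * antipode k (antipode k (b i))) *
      (DualHopf.equiv k H).symm (b.coord i)) * f) y = 0 := by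
    rw [Finset.sum_mul, map_sum, LinearMap.sum_apply]
    refine Finset.sum_eq_zero fun i _ => ?_
    rw [mul_assoc, ← apply_hitL, h1, map_zero]
  rw [h2] at h5
  simpa [hx] using h5

variable (k H) in
theorem antipode_surjective : Function.Surjective (antipode k (A := H)) :=
  LinearMap.injective_iff_surjective.mp (antipode_injective k H)

theorem isNilpotent_of_mem_jacobson (k : Type*) {R : Type*} [Field k] [Ring R] [Algebra k R]
    [FiniteDimensional k R] {x : R} (hx : x ∈ Ring.jacobson R) : IsNilpotent x := by
  have := IsArtinianRing.of_finite k R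
  obtain ⟨n, hn⟩ := IsSemiprimaryRing.isNilpotent (R := R)
  refine ⟨n, ?_⟩
  have := Ideal.pow_mem_pow hx n
  rwa [hn] at this

theorem mem_jacobson_of_forall_isNilpotent {R : Type*} [Ring R] {x : R}
    (h : ∀ y, IsNilpotent (y * x)) : x ∈ Ring.jacobson R := by
  rw [← Ideal.jacobson_bot, Ideal.mem_jacobson_iff]
  intro y
  obtain ⟨u, hu⟩ := (h y).isUnit_one_add
  refine ⟨↑u⁻¹, ?_⟩
  have : (↑u⁻¹ : R) * (1 + y * x) = 1 := by rw [← hu]; simp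
  rw [mul_add, mul_one] at this
  rw [← this, mul_assoc]
  simp [add_comm]

/-- Surjectivity lets one write y = S z, so y S(x) = S(x z) is nilpotent along with x z; nilpotency
of all multiples characterises the radical here. -/
theorem antipode_mem_jacobson {x : H} (hx : x ∈ Ring.jacobson H) :
    antipode k x ∈ Ring.jacobson H := by
  refine mem_jacobson_of_forall_isNilpotent fun y => ?_
  obtain ⟨z, rfl⟩ := antipode_surjective k H y
  rw [← antipode_mul_antidistrib]
  obtain ⟨n, hn⟩ := isNilpotent_of_mem_jacobson k (Ideal.mul_mem_right z _ hx)
  refine ⟨n, ?_⟩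
  have : ∀ m, antipode k (x * z) ^ m = antipode k ((x * z) ^ m) := by
    intro m
    induction m with
    | zero => simp
    | succ m ih => rw [pow_succ, ih, ← antipode_mul_antidistrib, ← pow_succ']
  rw [this, hn, map_zero]

end Bijective

theorem tensor_ext_of_forall_dual {k M N : Type*} [Field k] [AddCommGroup M] [Module k M]
    [AddCommGroup N] [Module k N] [FiniteDimensional k M] [FiniteDimensional k N] {s t : M ⊗[k] N}
    (h : ∀ (φ : Module.Dual k M) (ψ : Module.Dual k N),
      TensorProduct.dualDistrib k M N (φ ⊗ₜ ψ) s = TensorProduct.dualDistrib k M N (φ ⊗ₜ ψ) t) :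
    s = t := by
  rw [← sub_eq_zero, ← Module.forall_dual_apply_eq_zero_iff k]
  intro F
  obtain ⟨T, rfl⟩ := (TensorProduct.dualDistribEquiv k M N).surjective F
  change TensorProduct.dualDistrib k M N T (s - t) = 0
  induction T with
  | zero => simp
  | tmul φ ψ => rw [map_sub, h, sub_self]
  | add a b ha hb => rw [map_add, LinearMap.add_apply, ha, hb, add_zero]

/-! ### The regular character of H*, and semisimplicity of H when S² = 1 -/

section RegularCharacter

variable {k : Type v} {H : Type u} [Field k] [Ring H] [HopfAlgebra k H]

theorem dualMul_eq_dualDistrib (f g : DualHopf k H) (x : H) : (f * g) x =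
    TensorProduct.dualDistrib k H H ((DualHopf.equiv k H f) ⊗ₜ (DualHopf.equiv k H g))
      (comul x) := by
  rw [DualHopf.mul_apply_repr f g (ℛ k x)]
  conv_rhs => rw [← (ℛ k x).eq]
  simp

/-- The functional `x ↦ f(c x)`. -/
def dualMulLeft (f : DualHopf k H) (c : H) : DualHopf k H :=
  (DualHopf.equiv k H).symm (DualHopf.equiv k H f ∘ₗ LinearMap.mulLeft k c)

@[simp] theorem dualMulLeft_apply (f : DualHopf k H) (c x : H) :
    dualMulLeft f c x = f (c * x) := rfl

theorem rid_lTensor_one_tmul_mul (f : DualHopf k H) (t : H ⊗[k] H) (c : H) :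
    TensorProduct.rid k H ((DualHopf.equiv k H f).lTensor H (1 ⊗ₜ c * t)) =
      TensorProduct.rid k H ((DualHopf.equiv k H (dualMulLeft f c)).lTensor H t) := by
  induction t with
  | zero => simp
  | tmul a b => simp
  | add a b ha hb => simp only [mul_add, map_add, ha, hb]

theorem hitR_apply (f : DualHopf k H) (x : H) : hitR f x =
    TensorProduct.rid k H ((DualHopf.equiv k H f).lTensor H (comul x)) := rfl

/-- `∑ x₁ f(y x₂) = ∑ S(y₁) (y₂ x)₁ f((y₂ x)₂)`. -/
theorem hitR_dualMulLeft (f : DualHopf k H) {ι : Type*} {y : H} (r : Coalgebra.Repr k y ι) (x : H) :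
    hitR (dualMulLeft f y) x =
      ∑ i ∈ r.index, antipode k (r.left i) * hitR f (r.right i * x) := by
  rw [hitR_apply, ← rid_lTensor_one_tmul_mul, ← sum_antipode_tmul_one_mul_comul r, Finset.sum_mul]
  simp only [mul_assoc, ← Bialgebra.comul_mul, map_sum, rid_lTensor_tmul_one_mul]
  rfl

/-- A left integral in `H`. -/
def IsLeftIntegral (k : Type v) {H : Type u} [Field k] [Ring H] [HopfAlgebra k H] (t : H) : Prop :=
  ∀ x, x * t = counit (R := k) x • t

/-- A formula for the antipode in terms of a pair of integrals: if l(t) ≠ 0, then S y is determined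
by the functional l(y ·). -/
theorem IsLeftIntegral.hitR_dualMulLeft {t : H} (ht : IsLeftIntegral k t) {l : DualHopf k H}
    (hl : IsLeftIntegralForm l) (y : H) : hitR (dualMulLeft l y) t = l t • antipode k y := by
  rw [HopfChevalley.hitR_dualMulLeft l (ℛ k y)]
  simp only [ht _, map_smul, hl.hitR_eq, mul_smul_comm, mul_one]
  have := congrArg (antipode k) (hitR_repr (1 : DualHopf k H) (ℛ k y))
  rw [hitR_one, Module.End.one_apply] at this
  simp only [map_sum, map_smul, DualHopf.one_apply] at this
  rw [this, Finset.smul_sum]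
  exact Finset.sum_congr rfl fun i _ => by rw [smul_eq_mul, smul_smul, mul_comm]

variable [FiniteDimensional k H]

variable (k H) in
/-- The character of the regular representation of `H*`, as an element of `H`. -/
def regularChar : H :=
  ∑ i, hitL ((DualHopf.equiv k H).symm ((Module.finBasis k H).coord i)) (Module.finBasis k H i)

theorem apply_regularChar (f : DualHopf k H) :
    f (regularChar k H) = LinearMap.trace k H (hitR f) := by
  rw [LinearMap.trace_eq_matrix_trace k (Module.finBasis k H), Matrix.trace, regularChar, map_sum]
  refine Finset.sum_congr rfl fun i _ => ?_
  rw [apply_hitL, Matrix.diag_apply, LinearMap.toMatrix_apply, ← apply_hitR]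
  rfl

/-- Pairing y Λ with f gives the trace of ∑ L_{S y₁} ∘ `hitR f` ∘ L_{y₂}; cyclicity brings the
factors together as y₂ S(y₁). The hypothesis `hy` follows from S² = 1, and also holds for
cocommutative y. -/
theorem mul_regularChar {ι : Type*} {y : H} (r : Coalgebra.Repr k y ι)
    (hy : ∑ i ∈ r.index, r.right i * antipode k (r.left i) = counit (R := k) y • 1) :
    y * regularChar k H = counit (R := k) y • regularChar k H := by
  refine ext_of_forall_dual (k := k) fun f => ?_
  rw [← dualMulLeft_apply, apply_regularChar, map_smul, apply_regularChar]
  have h1 : hitR (dualMulLeft f y) = ∑ i ∈ r.index, LinearMap.mulLeft k (antipode k (r.left i)) *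
      (hitR f * LinearMap.mulLeft k (r.right i)) := by
    ext x
    simp [hitR_dualMulLeft f r]
  have h2 : ∀ i, LinearMap.trace k H (LinearMap.mulLeft k (antipode k (r.left i)) *
      (hitR f * LinearMap.mulLeft k (r.right i))) = LinearMap.trace k H
        (hitR f * LinearMap.mulLeft k (r.right i * antipode k (r.left i))) := by
    intro i
    rw [LinearMap.trace_mul_comm, LinearMap.mulLeft_mul, mul_assoc]
    rfl
  rw [h1, map_sum]
  simp only [h2]
  rw [← map_sum, ← Finset.mul_sum]
  have h3 : ∑ i ∈ r.index, LinearMap.mulLeft k (r.right i * antipode k (r.left i)) =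
      counit (R := k) y • 1 := by
    ext x
    have := congrArg (· * x) hy
    simpa [Finset.sum_mul, mul_assoc] using this
  rw [h3]
  simp

theorem counit_regularChar : counit (R := k) (regularChar k H) = Module.finrank k H := by
  have := apply_regularChar (1 : DualHopf k H)
  rwa [hitR_one, LinearMap.trace_one] at this

/-- Λ is a character of H*, and Tr(AB) = Tr(BA). -/
theorem comm_comul_regularChar : TensorProduct.comm k H H (comul (R := k) (regularChar k H)) =
    comul (R := k) (regularChar k H) := by
  refine tensor_ext_of_forall_dual fun φ ψ => ?_
  have h1 : ∀ t : H ⊗[k] H, TensorProduct.dualDistrib k H H (φ ⊗ₜ ψ) (TensorProduct.comm k H H t) =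
      TensorProduct.dualDistrib k H H (ψ ⊗ₜ φ) t := by
    intro t
    induction t with
    | zero => simp
    | tmul a b => simp [mul_comm]
    | add a b ha hb => simp only [map_add, ha, hb]
  rw [h1]
  have h2 := dualMul_eq_dualDistrib ((DualHopf.equiv k H).symm φ) ((DualHopf.equiv k H).symm ψ)
    (regularChar k H)
  have h3 := dualMul_eq_dualDistrib ((DualHopf.equiv k H).symm ψ) ((DualHopf.equiv k H).symm φ)
    (regularChar k H)
  simp only [LinearEquiv.apply_symm_apply] at h2 h3
  rw [← h2, ← h3, apply_regularChar, apply_regularChar, hitR_mul, hitR_mul,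
    LinearMap.trace_mul_comm]

/-- Cocommutativity of Λ turns ∑ Λ₁ S(Λ₂) = ε(Λ) into the hypothesis of `mul_regularChar`, with no
assumption on S². -/
theorem regularChar_mul_self : regularChar k H * regularChar k H =
    (Module.finrank k H : k) • regularChar k H := by
  rw [← counit_regularChar]
  refine mul_regularChar (ℛ k _) ?_
  have h1 := congrArg (LinearMap.mul' k H ∘ₗ (antipode k (A := H)).lTensor H)
    (comm_comul_regularChar (k := k) (H := H))
  rw [LinearMap.comp_apply, LinearMap.comp_apply, mul_antipode_lTensor_comul_apply,
    Algebra.algebraMap_eq_smul_one] at h1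
  rw [← h1]
  conv_rhs => rw [← (ℛ k (regularChar k H)).eq]
  simp

/-- When S² = 1, l = `traceForm 1` is the character of the regular representation of H and Λ is a
left integral, with l(Λ) = l(1) = dim H ≠ 0. For j in the radical, j x is nilpotent, so l(j x) = 0
for all x; then l(Λ) S(j) = ∑ Λ₁ l(j Λ₂) = 0. -/
theorem jacobson_eq_bot_of_antipode_antipode [CharZero k]
    (hS : ∀ x : H, antipode k (antipode k x) = x) : Ring.jacobson H = ⊥ := by
  have ht : IsLeftIntegral k (regularChar k H) := by
    intro y
    refine mul_regularChar (ℛ k y) ?_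
    have := congrArg (antipode k) (sum_mul_antipode_eq_smul (ℛ k y))
    simpa [antipode_mul_antidistrib, hS] using this
  have hl := isLeftIntegralForm_traceForm (1 : DualHopf k H)
  have hl' : ∀ x, traceForm (1 : DualHopf k H) x = LinearMap.trace k H (LinearMap.mulLeft k x) := by
    intro x
    rw [traceForm_apply, hitR_one, one_mul]
    congr 1
    ext y
    simp [hS]
  have hne : traceForm (1 : DualHopf k H) (regularChar k H) ≠ 0 := by
    rw [apply_regularChar]
    have : hitR (traceForm (1 : DualHopf k H)) =
        LinearMap.smulRight (DualHopf.equiv k H (traceForm (1 : DualHopf k H))) 1 := by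
      ext x
      simp [hl.hitR_eq]
    rw [this, LinearMap.trace_smulRight, hl', LinearMap.mulLeft_one, LinearMap.trace_id]
    have : Nontrivial H := by
      refine ⟨1, 0, fun h => ?_⟩
      have := congrArg (counit (R := k)) h
      simp at this
    exact_mod_cast (Module.finrank_pos (R := k) (M := H)).ne'
  rw [eq_bot_iff]
  intro j hj
  have h0 : dualMulLeft (traceForm (1 : DualHopf k H)) j = 0 := by
    ext x
    rw [dualMulLeft_apply, hl']
    obtain ⟨n, hn⟩ := isNilpotent_of_mem_jacobson k (Ideal.mul_mem_right x _ hj)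
    have : IsNilpotent (LinearMap.mulLeft k (j * x)) :=
      ⟨n, by rw [LinearMap.pow_mulLeft, hn, LinearMap.mulLeft_zero_eq_zero]⟩
    simpa using LinearMap.isNilpotent_trace_of_isNilpotent this
  have := ht.hitR_dualMulLeft hl j
  rw [h0] at this
  have h1 : antipode k j = 0 := by
    have : (0 : H) = traceForm (1 : DualHopf k H) (regularChar k H) • antipode k j := by
      rw [← this]; simp [hitR]
    simpa [hne] using this.symm
  rw [Ideal.mem_bot, ← hS j, h1, map_zero]

end RegularCharacter

/-! ### Traces of finite-order automorphisms of products of complex matrix algebras -/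

section MatrixTrace

open Matrix
open scoped ComplexOrder

theorem trace_inv_eq_star_of_pow_eq_one {n : Type*} [Fintype n] [DecidableEq n]
    {v y : Matrix n n ℂ} (hvy : v * y = 1) {N : ℕ} (hN : 0 < N) (hv : v ^ N = 1) :
    y.trace = star v.trace := by
  -- Weyl's trick: averaging the standard form over the powers of v makes v unitary for B, hence v⁻¹
  -- = B⁻¹ vᴴ B. The term i = 0 is the identity, which makes B positive definite.
  let B : Matrix n n ℂ := ∑ i ∈ Finset.range N, (v ^ i)ᴴ * v ^ i
  have hB : B.PosDef := by
    have h1 : ∀ i, ((v ^ i)ᴴ * v ^ i).PosSemidef := fun i => posSemidef_conjTranspose_mul_self _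
    obtain ⟨M, rfl⟩ : ∃ M, N = M + 1 := ⟨N - 1, by omega⟩
    simp only [B]
    rw [Finset.sum_range_succ']
    refine PosDef.posSemidef_add (posSemidef_sum _ fun i _ => h1 _) ?_
    simpa using PosDef.one
  have hBv : vᴴ * B * v = B := by
    simp only [B, Finset.mul_sum, Finset.sum_mul]
    have h2 : ∀ i, vᴴ * ((v ^ i)ᴴ * v ^ i) * v = (v ^ (i + 1))ᴴ * v ^ (i + 1) := by
      intro i
      rw [pow_succ, conjTranspose_mul]
      simp only [mul_assoc]
    simp only [h2]
    have := Finset.sum_range_succ (fun i => (v ^ i)ᴴ * v ^ i) N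
    rw [Finset.sum_range_succ'] at this
    simpa [hv] using this
  have hu : IsUnit B.det := (B.isUnit_iff_isUnit_det).mp hB.isUnit
  have hy : y = B⁻¹ * vᴴ * B := by
    have : vᴴ * B = B * y := by
      rw [← hBv, mul_assoc _ v y, hvy, mul_one, hBv]
    rw [mul_assoc, this, ← mul_assoc, nonsing_inv_mul _ hu, one_mul]
  rw [hy, trace_mul_comm, ← mul_assoc, mul_nonsing_inv _ hu, one_mul, trace_conjTranspose]

/-- Dividing w by an N-th root of c makes it of finite order and leaves tr(w) tr(w⁻¹) unchanged; the
product is then |tr|² of the rescaled matrix. -/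
theorem trace_mul_trace_inv {n : Type*} [Fintype n] [DecidableEq n] [Nonempty n]
    {w y : Matrix n n ℂ} (hwy : w * y = 1) {N : ℕ} (hN : 0 < N) {c : ℂ} (hw : w ^ N = c • 1) :
    ∃ s : ℝ, w.trace * y.trace = s ∧ 0 ≤ s ∧ (w.trace ≠ 0 → 0 < s) := by
  obtain ⟨r, hr⟩ := IsAlgClosed.exists_pow_nat_eq c hN
  have hyw : y * w = 1 := mul_eq_one_comm.mp hwy
  have hc : c ≠ 0 := by
    rintro rfl
    have : IsUnit (w ^ N) := (IsUnit.of_mul_eq_one _ hwy).pow N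
    rw [hw, zero_smul] at this
    exact not_isUnit_zero this
  have hr0 : r ≠ 0 := by
    rintro rfl
    exact hc (by rw [← hr, zero_pow hN.ne'])
  have h1 : (r⁻¹ • w) * (r • y) = 1 := by
    rw [smul_mul_smul_comm, inv_mul_cancel₀ hr0, hwy, one_smul]
  have h2 : (r⁻¹ • w) ^ N = 1 := by
    rw [smul_pow, hw, inv_pow, hr, smul_smul, inv_mul_cancel₀ hc, one_smul]
  have h3 := trace_inv_eq_star_of_pow_eq_one h1 hN h2
  have h4 : w.trace * y.trace = (r⁻¹ • w).trace * (r • y).trace := by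
    rw [trace_smul, trace_smul]
    simp only [smul_eq_mul]
    field_simp
  refine ⟨Complex.normSq (r⁻¹ • w).trace, ?_, Complex.normSq_nonneg _, fun h => ?_⟩
  · rw [h4, h3]
    exact Complex.mul_conj _
  · rw [Complex.normSq_pos, trace_smul]
    exact smul_ne_zero (inv_ne_zero hr0) h

theorem exists_scalar_of_forall_commute {n : Type*} [Fintype n] [DecidableEq n]
    {w : Matrix n n ℂ} (h : ∀ x, w * x = x * w) : ∃ c : ℂ, w = c • 1 := by
  obtain ⟨c, hc⟩ := mem_range_scalar_of_commute_single (M := w) fun i j _ => (h _).symm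
  exact ⟨c, by rw [← hc, scalar_apply, smul_one_eq_diagonal]⟩

variable {ι : Type*} [Fintype ι] [DecidableEq ι] {d : ι → ℕ}

theorem exists_trace_mul_eq (φ : (Π i, Matrix (Fin (d i)) (Fin (d i)) ℂ) →ₗ[ℂ] ℂ) :
    ∃ u : Π i, Matrix (Fin (d i)) (Fin (d i)) ℂ, ∀ x, φ x = ∑ i, (u i * x i).trace := by
  refine ⟨fun i => Matrix.of fun p q => φ (Pi.single i (Matrix.single q p 1)), fun x => ?_⟩
  have h1 : x = ∑ i, Pi.single i (x i) := (Finset.univ_sum_single x).symm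
  conv_lhs => rw [h1]
  rw [map_sum]
  refine Finset.sum_congr rfl fun i _ => ?_
  have h2 : Pi.single i (x i) = ∑ p, ∑ q,
      x i p q • (Pi.single i (Matrix.single p q 1) : Π i, Matrix (Fin (d i)) (Fin (d i)) ℂ) := by
    conv_lhs => rw [matrix_eq_sum_single (x i)]
    rw [← LinearMap.coe_single (R := ℂ)]
    simp only [map_sum, ← map_smul, Matrix.smul_single, smul_eq_mul, mul_one]
  rw [h2]
  simp only [map_sum, map_smul, Matrix.trace, Matrix.diag_apply, Matrix.mul_apply, Matrix.of_apply,
    smul_eq_mul]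
  rw [Finset.sum_comm]
  exact Finset.sum_congr rfl fun _ _ => Finset.sum_congr rfl fun _ _ => mul_comm _ _

theorem trace_mulLeft_mulRight_pi (u v : Π i, Matrix (Fin (d i)) (Fin (d i)) ℂ) :
    LinearMap.trace ℂ _ (LinearMap.mulLeft ℂ u * LinearMap.mulRight ℂ v) =
      ∑ i, (u i).trace * (v i).trace := by
  rw [LinearMap.trace_eq_matrix_trace ℂ
    (Pi.basis fun i => Matrix.stdBasis ℂ (Fin (d i)) (Fin (d i))), Matrix.trace,
    Fintype.sum_sigma]
  refine Finset.sum_congr rfl fun i _ => ?_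
  rw [Fintype.sum_prod_type, Matrix.trace, Matrix.trace, Finset.sum_mul_sum]
  refine Finset.sum_congr rfl fun p _ => Finset.sum_congr rfl fun q _ => ?_
  rw [Matrix.diag_apply, LinearMap.toMatrix_apply, Pi.basis_repr, Pi.basis_apply,
    Matrix.stdBasis_eq_single]
  simp only [Module.End.mul_apply, LinearMap.mulRight_apply, LinearMap.mulLeft_apply, Pi.mul_apply,
    Pi.single_eq_same]
  rw [show ∀ X : Matrix (Fin (d i)) (Fin (d i)) ℂ,
    (Matrix.stdBasis ℂ (Fin (d i)) (Fin (d i))).repr X (p, q) = X p q from fun X => by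
      simp [Matrix.stdBasis]]
  simp [Matrix.mul_apply, Matrix.single_apply, ite_and, Finset.sum_ite_eq]

/-- An automorphism of finite order of a product of matrix algebras that is the Nakayama
automorphism of a Frobenius form which is nonzero on some central element has nonzero trace. -/
theorem trace_ne_zero_of_nakayama [∀ i, NeZero (d i)]
    {σ : Module.End ℂ (Π i, Matrix (Fin (d i)) (Fin (d i)) ℂ)} {N : ℕ} (hN : 0 < N)
    (hσ : σ ^ N = 1) {φ : (Π i, Matrix (Fin (d i)) (Fin (d i)) ℂ) →ₗ[ℂ] ℂ}
    (hφ : ∀ j x, φ (j * x) = φ (x * σ j)) (hnd : ∀ y, (∀ x, φ (x * y) = 0) → y = 0)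
    {c : Π i, Matrix (Fin (d i)) (Fin (d i)) ℂ} (hc : ∀ x, c * x = x * c) (hφc : φ c ≠ 0) :
    LinearMap.trace ℂ _ σ ≠ 0 := by
  obtain ⟨u, hu⟩ := exists_trace_mul_eq φ
  have hcyc : ∀ x y : Π i, Matrix (Fin (d i)) (Fin (d i)) ℂ,
      ∑ i, (x i * y i).trace = ∑ i, (y i * x i).trace :=
    fun x y => Finset.sum_congr rfl fun i _ => trace_mul_comm _ _
  have hτ : ∀ y z : Π i, Matrix (Fin (d i)) (Fin (d i)) ℂ,
      (∀ x : Π i, Matrix (Fin (d i)) (Fin (d i)) ℂ,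
        ∑ i, (y i * x i).trace = ∑ i, (z i * x i).trace) → y = z := by
    intro y z h
    ext i p q
    have h1 := h (Pi.single i (Matrix.single q p 1))
    rw [Finset.sum_eq_single i, Finset.sum_eq_single i] at h1
    · simpa [Matrix.trace, Matrix.mul_apply, Matrix.single_apply, ite_and] using h1
    all_goals simp +contextual
  have hinj : ∀ y, y * u = 0 → y = 0 := by
    intro y hy
    refine hnd y fun x => ?_
    rw [hu]
    have := hcyc (u * x) y
    simp only [Pi.mul_apply] at this ⊢
    have h1 : ∀ i, y i * u i = 0 := fun i => congrFun hy i
    simp only [← mul_assoc] at this ⊢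
    simp [this, h1]
  obtain ⟨v, hv⟩ : ∃ v, v * u = 1 := by
    have : Function.Injective (LinearMap.mulRight ℂ u) := by
      rw [injective_iff_map_eq_zero]
      exact hinj
    exact LinearMap.injective_iff_surjective.mp this 1
  have huv : u * v = 1 := by
    rw [← sub_eq_zero]
    refine hinj _ ?_
    rw [sub_mul, mul_assoc, hv]; simp
  have hσu : ∀ j, u * j = σ j * u := by
    intro j
    refine hτ _ _ fun x => ?_
    have h1 := hφ j x
    rw [hu, hu] at h1
    have h2 := hcyc (u * x) (σ j)
    simp only [Pi.mul_apply, mul_assoc] at h1 h2 ⊢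
    rw [h1, h2]
  -- Writing φ as the trace against u turns the Nakayama identity into u j = σ(j) u, so σ is
  -- conjugation by u, which is invertible because φ is nondegenerate.
  have hσ' : σ = LinearMap.mulLeft ℂ u * LinearMap.mulRight ℂ v := by
    refine LinearMap.ext fun j => ?_
    simp only [Module.End.mul_apply, LinearMap.mulRight_apply, LinearMap.mulLeft_apply]
    rw [← mul_assoc, hσu, mul_assoc, huv, mul_one]
  have hpow : ∀ n j, u ^ n * j = (σ ^ n) j * u ^ n := by
    intro n
    induction n with
    | zero => simp
    | succ n ih =>
      intro j
      rw [pow_succ u, mul_assoc, hσu, ← mul_assoc, ih, mul_assoc, ← pow_succ, pow_succ σ]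
      rfl
  have hscal : ∀ x : Π i, Matrix (Fin (d i)) (Fin (d i)) ℂ, (∀ y, x * y = y * x) →
      ∀ i, ∃ γ : ℂ, x i = γ • 1 := by
    intro x hx i
    refine exists_scalar_of_forall_commute fun y => ?_
    simpa using congrFun (hx (Pi.single i y)) i
  -- As σ^N = 1, the power u^N is central, hence scalar in each block.
  have huN : ∀ i, ∃ γ : ℂ, u i ^ N = γ • 1 :=
    hscal (u ^ N) fun y => by rw [hpow, hσ]; rfl
  choose γ hγ using huN
  have hne : ∀ i, Nonempty (Fin (d i)) := fun i => inferInstance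
  choose s hs hs0 hspos using fun i =>
    trace_mul_trace_inv (show u i * v i = 1 from congrFun huv i) hN (hγ i)
  -- The central element c is a scalar δᵢ in each block, so φ(c) = ∑ δᵢ tr(uᵢ) would vanish if all
  -- these traces did.
  obtain ⟨i, hi⟩ : ∃ i, (u i).trace ≠ 0 := by
    by_contra! h
    choose δ hδ using hscal c hc
    refine hφc ?_
    rw [hu]
    simp [hδ, h]
  rw [hσ', trace_mulLeft_mulRight_pi]
  simp only [hs]
  rw [← Complex.ofReal_sum, Complex.ofReal_ne_zero]
  exact (Finset.sum_pos' (fun i _ => hs0 i) ⟨i, Finset.mem_univ i, hspos i hi⟩).ne'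

end MatrixTrace

/-! ### Integrals of a semisimple augmented algebra -/

section TwoSidedIntegral

/-- Take t to be the component of 1 in a left ideal I complementary to ker ε: x t − ε(x) t lies in I
∩ ker ε = 0. -/
theorem exists_left_integral_of_augmentation {k R : Type*} [Field k] [Ring R] [Algebra k R]
    [IsSemisimpleRing R] (ε : R →ₐ[k] k) : ∃ t : R, (∀ x, x * t = ε x • t) ∧ ε t = 1 := by
  obtain ⟨I, hI⟩ := exists_isCompl (RingHom.ker ε : Ideal R)
  obtain ⟨c, hc, t, ht, hct⟩ := Submodule.mem_sup.mp
    (show (1 : R) ∈ (RingHom.ker ε : Ideal R) ⊔ I by rw [hI.sup_eq_top]; trivial)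
  have hεt : ε t = 1 := by
    have := congrArg ε hct
    rwa [map_add, map_one, (RingHom.mem_ker).mp hc, zero_add] at this
  refine ⟨t, fun x => ?_, hεt⟩
  rw [← sub_eq_zero, ← Submodule.mem_bot R, ← hI.inf_eq_bot]
  refine ⟨?_, I.sub_mem (I.mul_mem_left _ ht) ?_⟩
  · refine RingHom.mem_ker.mpr ?_
    simp [hεt]
  · rw [Algebra.smul_def]
    exact I.mul_mem_left _ ht

theorem exists_two_sided_integral_of_augmentation {k R : Type*} [Field k] [Ring R] [Algebra k R]
    [IsSemisimpleRing R] (ε : R →ₐ[k] k) :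
    ∃ t : R, (∀ x, x * t = ε x • t) ∧ (∀ x, t * x = ε x • t) ∧ ε t = 1 := by
  obtain ⟨t, ht, hεt⟩ := exists_left_integral_of_augmentation ε
  let ε' : Rᵐᵒᵖ →ₐ[k] k :=
    { toFun x := ε x.unop
      map_one' := map_one ε
      map_mul' x y := by simp [mul_comm]
      map_zero' := map_zero ε
      map_add' x y := map_add ε _ _
      commutes' c := by simp }
  obtain ⟨s, hs, hεs⟩ := exists_left_integral_of_augmentation ε'
  have hs' : ∀ x, s.unop * x = ε x • s.unop := fun x => congrArg MulOpposite.unop (hs (.op x))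
  have hεs' : ε s.unop = 1 := hεs
  -- Computing s t with the left integral t and with the right integral s gives both t and s.
  have : t = s.unop := by
    have h1 := ht s.unop
    rw [hεs', one_smul, hs', hεt, one_smul] at h1
    exact h1.symm
  exact ⟨t, ht, this ▸ hs', hεt⟩

end TwoSidedIntegral

/-! ### Radford's formula for S⁴, and the finite order of S² -/

section Semisimple

variable {k : Type v} {H : Type u} [Field k] [Ring H] [HopfAlgebra k H]

/-- A right integral on `H`: `∑ m(x₁) x₂ = m(x) 1`. -/
def IsRightIntegralForm (m : DualHopf k H) : Prop := ∀ f : DualHopf k H, m * f = f 1 • m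

theorem IsRightIntegralForm.hitL_eq {m : DualHopf k H} (hm : IsRightIntegralForm m) (x : H) :
    hitL m x = m x • 1 :=
  ext_of_forall_dual (k := k) fun f => by
    rw [apply_hitL, hm f]; simp [mul_comm]

variable (k) in
/-- A normalised two-sided integral in `H`. -/
structure IsNormalizedIntegral (t : H) : Prop where
  mul_left : ∀ x, x * t = counit (R := k) x • t
  mul_right : ∀ x, t * x = counit (R := k) x • t
  counit_eq : counit (R := k) t = 1

variable (k H) in
theorem exists_isNormalizedIntegral [IsSemisimpleRing H] : ∃ t : H, IsNormalizedIntegral k t := by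
  obtain ⟨t, h1, h2, h3⟩ := exists_two_sided_integral_of_augmentation (Bialgebra.counitAlgHom k H)
  exact ⟨t, h1, h2, h3⟩

/-- Since S² is multiplicative, L_{S² m} S² = S² L_m; cyclicity then moves L_m to the front. -/
theorem traceForm_one_nakayama [FiniteDimensional k H] (m x : H) :
    traceForm (1 : DualHopf k H) (m * x) =
      traceForm (1 : DualHopf k H) (x * antipode k (antipode k m)) := by
  rw [traceForm_apply, traceForm_apply, hitR_one, one_mul, one_mul, LinearMap.mulLeft_mul]
  have : LinearMap.mulLeft k (x * antipode k (antipode k m)) * antipodeSq k H =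
      LinearMap.mulLeft k x * antipodeSq k H * LinearMap.mulLeft k m := by
    ext y
    simp [antipode_mul_antidistrib, mul_assoc]
  rw [this, LinearMap.trace_mul_comm k (_ * _) (LinearMap.mulLeft k m), ← mul_assoc]
  rfl

theorem traceForm_one_one : traceForm (1 : DualHopf k H) 1 =
    LinearMap.trace k H (antipodeSq k H) := by
  rw [traceForm_apply, hitR_one, one_mul, LinearMap.mulLeft_one]
  rfl

theorem isRightIntegralForm_dualAntipode [FiniteDimensional k H] {l : DualHopf k H}
    (hl : IsLeftIntegralForm l) : IsRightIntegralForm (dualAntipode l) := by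
  have hfin : FiniteDimensional k (DualHopf k H) :=
    Module.Finite.equiv (DualHopf.equiv k H).symm
  intro f
  obtain ⟨g, rfl⟩ := antipode_surjective k (DualHopf k H) f
  have h1 := antipode_mul_antidistrib (R := k) g l
  rw [hl g] at h1
  have h2 : ∀ g : DualHopf k H, antipode k g = dualAntipode g := fun _ => rfl
  rw [map_smul, h2, h2] at h1
  rw [h2, ← h1]
  simp

namespace IsNormalizedIntegral

variable {t : H}

theorem comul_mul_tmul_one (ht : IsNormalizedIntegral k t) (h : H) :
    comul (R := k) t * h ⊗ₜ[k] (1 : H) = comul (R := k) t * (1 : H) ⊗ₜ[k] antipode k h := by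
  rw [← sum_comul_mul_one_tmul_antipode (ℛ k h), Finset.mul_sum]
  simp only [← mul_assoc, ← Bialgebra.comul_mul, ht.mul_right, map_smul, smul_mul_assoc]
  have : h = ∑ i ∈ (ℛ k h).index, counit (R := k) ((ℛ k h).left i) • (ℛ k h).right i :=
    (sum_counit_smul (ℛ k h)).symm
  conv_rhs => rw [this]
  simp only [map_sum, map_smul, TensorProduct.tmul_sum, TensorProduct.tmul_smul, Finset.mul_sum,
    mul_smul_comm]

theorem hitR_dualMulRight_antipode (ht : IsNormalizedIntegral k t) (f : DualHopf k H) (h : H) :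
    hitR (dualMulRight f (antipode k h)) t = hitR f t * h := by
  rw [hitR_apply, ← rid_lTensor_mul_one_tmul, ← ht.comul_mul_tmul_one, rid_lTensor_mul_tmul_one]
  rfl

theorem hitL_dualMulRight (ht : IsNormalizedIntegral k t) (f : DualHopf k H) (h : H) :
    hitL (dualMulRight f h) t = hitL f t * antipode k h := by
  have : ∀ (g : DualHopf k H) (x : H), hitL g x =
    TensorProduct.lid k H ((DualHopf.equiv k H g).rTensor H (comul x)) := fun _ _ => rfl
  rw [this, ← lid_rTensor_mul_tmul_one, ht.comul_mul_tmul_one, lid_rTensor_mul_one_tmul]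
  rfl

variable [FiniteDimensional k H]

theorem traceForm_one_apply (ht : IsNormalizedIntegral k t) :
    traceForm (1 : DualHopf k H) t = 1 := by
  rw [traceForm_apply, hitR_one, one_mul]
  have : LinearMap.mulLeft k t * antipodeSq k H =
      LinearMap.smulRight (counit (R := k) (A := H)) t := by
    ext y
    simp [ht.mul_right]
  rw [this, LinearMap.trace_smulRight, ht.counit_eq]

theorem hitR_traceForm (ht : IsNormalizedIntegral k t) (h : H) :
    hitR (dualMulRight (traceForm (1 : DualHopf k H)) (antipode k h)) t = h := by
  rw [ht.hitR_dualMulRight_antipode, (isLeftIntegralForm_traceForm _).hitR_eq,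
    ht.traceForm_one_apply, one_smul, one_mul]

theorem eq_zero_of_traceForm (ht : IsNormalizedIntegral k t) {y : H}
    (hy : ∀ x, traceForm (1 : DualHopf k H) (x * y) = 0) :
    y = 0 := by
  obtain ⟨h, rfl⟩ := antipode_surjective k H y
  have h1 : dualMulRight (traceForm (1 : DualHopf k H)) (antipode k h) = 0 := by
    ext x
    simp [hy]
  have h2 : h = 0 := by
    rw [← ht.hitR_traceForm h, h1]
    simp [hitR]
  rw [h2, map_zero]

/-- H* is generated from t: f ↦ ∑ t₁ f(t₂) hits every h by `hitR_traceForm`, and the two spaces have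
the same dimension. -/
theorem eq_of_hitR_eq (ht : IsNormalizedIntegral k t) {f g : DualHopf k H}
    (hfg : hitR f t = hitR g t) : f = g := by
  let Ψ : DualHopf k H →ₗ[k] H :=
    { toFun f := hitR f t
      map_add' f g := by rw [hitR_add]; rfl
      map_smul' c f := by rw [hitR_smul]; rfl }
  have hsurj : Function.Surjective Ψ := fun h => ⟨_, ht.hitR_traceForm h⟩
  have hfin : FiniteDimensional k (DualHopf k H) :=
    Module.Finite.equiv (DualHopf.equiv k H).symm
  have hrank : Module.finrank k (DualHopf k H) = Module.finrank k H := by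
    rw [(DualHopf.equiv k H).finrank_eq]
    exact Subspace.dual_finrank_eq
  exact (LinearMap.injective_iff_surjective_of_finrank_eq_finrank hrank).mpr hsurj hfg

/-- Uniqueness of right integrals up to scalars: every y is ∑ t₁ g(t₂) for some g, so m(y) = (m *
g)(t) = g(∑ m(t₁) t₂) = m(t) g(1). -/
theorem eq_zero_of_isRightIntegralForm (ht : IsNormalizedIntegral k t) {m : DualHopf k H}
    (hm : IsRightIntegralForm m)
    (h0 : m t = 0) : m = 0 := by
  ext y
  have h1 : hitL (dualMulRight m 1) t = 0 := by
    rw [ht.hitL_dualMulRight, hm.hitL_eq, h0, zero_smul, zero_mul]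
  have h2 : dualMulRight m 1 = m := by ext x; simp
  rw [h2] at h1
  have h3 := apply_hitL (dualMulRight (traceForm (1 : DualHopf k H)) (antipode k y)) m t
  rw [h1, ← apply_hitR, ht.hitR_traceForm] at h3
  rw [← h3]
  simp

theorem antipode_eq (ht : IsNormalizedIntegral k t) : antipode k t = t := by
  have h1 : ∀ x, antipode k t * x = counit (R := k) x • antipode k t := by
    intro x
    obtain ⟨y, rfl⟩ := antipode_surjective k H x
    rw [← antipode_mul_antidistrib, ht.mul_left]
    simp
  have h2 := h1 t
  rwa [ht.mul_left, counit_antipode, ht.counit_eq, one_smul, one_smul, eq_comm] at h2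

end IsNormalizedIntegral

variable (k) in
/-- The distinguished grouplike element attached to a normalised integral `t`. -/
def distinguished [FiniteDimensional k H] (t : H) : H :=
  hitR (dualAntipode (traceForm (1 : DualHopf k H))) t

namespace IsNormalizedIntegral

variable {t : H} [FiniteDimensional k H]

/-- Left multiplication by f preserves right integrals, hence acts on l ∘ S by a scalar; evaluating
at t, where l ∘ S is 1, identifies the scalar as f(a), with a the distinguished element. -/
theorem mul_dualAntipode_traceForm (ht : IsNormalizedIntegral k t) (f : DualHopf k H) :
    f * dualAntipode (traceForm (1 : DualHopf k H)) =
      f (distinguished k t) • dualAntipode (traceForm (1 : DualHopf k H)) := by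
  have hm := isRightIntegralForm_dualAntipode
    (isLeftIntegralForm_traceForm (1 : DualHopf k H))
  set m := dualAntipode (traceForm (1 : DualHopf k H)) with hmdef
  have hmt : m t = 1 := by
    rw [hmdef, dualAntipode_apply, ht.antipode_eq, ht.traceForm_one_apply]
  rw [← sub_eq_zero]
  refine ht.eq_zero_of_isRightIntegralForm (fun g => ?_) ?_
  · rw [sub_mul, mul_assoc, hm g, smul_mul_assoc, hm g, mul_smul_comm, smul_sub, smul_comm]
  · rw [map_sub, LinearMap.sub_apply, map_smul, LinearMap.smul_apply, hmt, distinguished, ← hmdef,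
      apply_hitR]
    simp

/-- The scalar by which f multiplies the right integral is multiplicative in f, so f ↦ f(a) is a
character of the algebra H*. -/
theorem isGroupLikeElem_distinguished (ht : IsNormalizedIntegral k t) :
    IsGroupLikeElem k (distinguished k t) := by
  have hmt : dualAntipode (traceForm (1 : DualHopf k H)) t = 1 := by
    rw [dualAntipode_apply, ht.antipode_eq, ht.traceForm_one_apply]
  have h := ht.mul_dualAntipode_traceForm
  have hval : ∀ f : DualHopf k H,
      (f * dualAntipode (traceForm (1 : DualHopf k H))) t = f (distinguished k t) := by
    intro f
    rw [h, map_smul, LinearMap.smul_apply, hmt]; simp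
  constructor
  · rw [← DualHopf.one_apply, ← hval, one_mul, hmt]
  · refine tensor_ext_of_forall_dual fun φ ψ => ?_
    have h2 := dualMul_eq_dualDistrib ((DualHopf.equiv k H).symm φ) ((DualHopf.equiv k H).symm ψ)
      (distinguished k t)
    simp only [LinearEquiv.apply_symm_apply] at h2
    rw [← h2, ← hval, mul_assoc, h, mul_smul_comm, map_smul, LinearMap.smul_apply, hval]
    simp [mul_comm]

theorem dualAntipode_traceForm_eq (ht : IsNormalizedIntegral k t) :
    dualAntipode (traceForm (1 : DualHopf k H)) =
    dualMulRight (traceForm (1 : DualHopf k H)) (antipode k (distinguished k t)) :=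
  ht.eq_of_hitR_eq (ht.hitR_traceForm _).symm

theorem mul_antipode_distinguished (ht : IsNormalizedIntegral k t) (m : H) :
    m * antipode k (distinguished k t) =
    antipode k (distinguished k t) * antipode k (antipode k (antipode k (antipode k m))) := by
  rw [← sub_eq_zero]
  refine ht.eq_zero_of_traceForm fun x => ?_
  have hμ : ∀ y, traceForm (1 : DualHopf k H) (y * antipode k (distinguished k t)) =
      traceForm (1 : DualHopf k H) (antipode k y) := fun y =>
    (congrArg (fun f : DualHopf k H => f y) ht.dualAntipode_traceForm_eq).symm
  -- With l(y S a) = l(S y) and two uses of l(m x) = l(x S² m): l(x m S a) = l(S m · S x) = l(S x ·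
  -- S³ m) = l(S(S² m · x)) = l(S² m · x S a) = l(x S a · S⁴ m).
  rw [mul_sub, map_sub, sub_eq_zero, ← mul_assoc, hμ, antipode_mul_antidistrib,
    traceForm_one_nakayama, ← antipode_mul_antidistrib, ← hμ, mul_assoc, traceForm_one_nakayama,
    mul_assoc]

theorem antipodeSq_mul_antipodeSq (ht : IsNormalizedIntegral k t) (m : H) :
    antipodeSq k H (antipodeSq k H m) =
    distinguished k t * m * antipode k (distinguished k t) := by
  rw [mul_assoc, ht.mul_antipode_distinguished, ← mul_assoc,
    ht.isGroupLikeElem_distinguished.mul_antipode_cancel, one_mul]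
  rfl

/-- Grouplike elements are linearly independent, so they form a finite group; S⁴ is conjugation by
one of them, and the factor 2 passes from S⁴ to S². -/
theorem exists_antipodeSq_pow_eq_one (ht : IsNormalizedIntegral k t) :
    ∃ N, 0 < N ∧ antipodeSq k H ^ N = 1 := by
  let g : GroupLike k H := ⟨distinguished k t, ht.isGroupLikeElem_distinguished⟩
  have : Finite (GroupLike k H) := (linearIndep_groupLikeVal (R := k) (A := H)).finite
  have hg : g ^ Nat.card (GroupLike k H) = 1 := pow_card_eq_one'
  refine ⟨2 * Nat.card (GroupLike k H), by have := Nat.card_pos (α := GroupLike k H); omega, ?_⟩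
  have h1 : ∀ n (m : H), ((antipodeSq k H ^ 2) ^ n) m = (g ^ n).val * m * (g⁻¹ ^ n).val := by
    intro n
    induction n with
    | zero => simp
    | succ n ih =>
      intro m
      rw [pow_succ', Module.End.mul_apply, ih, sq, Module.End.mul_apply,
        ht.antipodeSq_mul_antipodeSq, pow_succ' g, pow_succ g⁻¹, GroupLike.val_mul,
        GroupLike.val_mul]
      simp only [mul_assoc]
      rfl
  ext m
  rw [pow_mul, h1, inv_pow, hg]
  simp

/-- The right integral l ∘ S takes the value Tr S² ≠ 0 at 1. Evaluating f * (l ∘ S) = f(a) (l ∘ S)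
at 1 gives f(1) = f(a) for all f, so a = 1 and S⁴ is trivial. -/
theorem antipodeSq_sq_eq_one (ht : IsNormalizedIntegral k t)
    (hne : LinearMap.trace k H (antipodeSq k H) ≠ 0) :
    antipodeSq k H * antipodeSq k H = 1 := by
  have ha : distinguished k t = 1 := by
    refine ext_of_forall_dual (k := k) fun f => ?_
    have hm := isRightIntegralForm_dualAntipode
      (isLeftIntegralForm_traceForm (1 : DualHopf k H))
    have h1 := congrArg (fun f : DualHopf k H => f 1) (ht.mul_dualAntipode_traceForm f)
    have hm1 : dualAntipode (traceForm (1 : DualHopf k H)) 1 ≠ 0 := by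
      rwa [dualAntipode_apply, antipode_one, traceForm_one_one]
    have h2 : (f * dualAntipode (traceForm (1 : DualHopf k H))) 1 =
        f 1 * dualAntipode (traceForm (1 : DualHopf k H)) 1 := by
      rw [DualHopf.mul_apply]
      simp [Algebra.TensorProduct.one_def]
    simp only [h2, map_smul, LinearMap.smul_apply, smul_eq_mul] at h1
    exact (mul_right_cancel₀ hm1 h1).symm
  ext m
  rw [Module.End.mul_apply, ht.antipodeSq_mul_antipodeSq, ha]
  simp

end IsNormalizedIntegral

end Semisimple

/-! ### Integrality of traces of operators with eigenvalues in {0, 1, −1} -/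

section Cubic

variable {k V : Type*} [Field k] [AddCommGroup V] [Module k V] [FiniteDimensional k V]

theorem exists_nat_trace_of_mul_self {P : Module.End k V} (hP : P * P = P) :
    LinearMap.trace k V P = Module.finrank k (LinearMap.range P) := by
  have : IsIdempotentElem P := hP
  exact (LinearMap.IsIdempotentElem.isProj_range P this).trace

variable [CharZero k]

/-- M is the difference of the idempotents (M² ± M)/2, the projections to its eigenspaces for 1 and
−1, so the trace is a difference of ranks. -/
theorem exists_int_trace_of_cube {M : Module.End k V} (hM : M * M * M = M) :
    ∃ z : ℤ, LinearMap.trace k V M = z := by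
  have h2 : (2 : k) ≠ 0 := two_ne_zero
  have hM4 : M * M * (M * M) = M * M := by rw [← mul_assoc, hM]
  have hM3 : M * (M * M) = M := by rw [← mul_assoc, hM]
  have hP : ((2 : k)⁻¹ • (M * M + M)) * ((2 : k)⁻¹ • (M * M + M)) = (2 : k)⁻¹ • (M * M + M) := by
    rw [smul_mul_smul_comm]
    have : (M * M + M) * (M * M + M) = (2 : k) • (M * M + M) := by
      rw [mul_add, add_mul, add_mul, hM4, hM3, hM, two_smul]; abel
    rw [this, smul_smul, mul_assoc, inv_mul_cancel₀ h2, mul_one]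
  have hQ : ((2 : k)⁻¹ • (M * M - M)) * ((2 : k)⁻¹ • (M * M - M)) = (2 : k)⁻¹ • (M * M - M) := by
    rw [smul_mul_smul_comm]
    have : (M * M - M) * (M * M - M) = (2 : k) • (M * M - M) := by
      rw [mul_sub, sub_mul, sub_mul, hM4, hM3, hM, two_smul]; abel
    rw [this, smul_smul, mul_assoc, inv_mul_cancel₀ h2, mul_one]
  have h1 : M = (2 : k)⁻¹ • (M * M + M) - (2 : k)⁻¹ • (M * M - M) := by
    rw [← smul_sub, show M * M + M - (M * M - M) = (2 : k) • M by rw [two_smul]; abel, smul_smul,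
      inv_mul_cancel₀ h2, one_smul]
  refine ⟨Module.finrank k (LinearMap.range ((2 : k)⁻¹ • (M * M + M))) -
    Module.finrank k (LinearMap.range ((2 : k)⁻¹ • (M * M - M))), ?_⟩
  rw [h1, map_sub, exists_nat_trace_of_mul_self hP, exists_nat_trace_of_mul_self hQ, ← h1]
  push_cast
  rfl

/-- A linear involution whose trace is a nonzero multiple of the dimension is `1` or `-1`. -/
theorem eq_one_or_eq_neg_one_of_trace {σ : Module.End k V} (hσ : σ * σ = 1) {z : ℤ}
    (hz : LinearMap.trace k V σ = Module.finrank k V * z) (hz0 : LinearMap.trace k V σ ≠ 0) :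
    σ = 1 ∨ σ = -1 := by
  have h2 : (2 : k) ≠ 0 := two_ne_zero
  set P : Module.End k V := (2 : k)⁻¹ • (1 + σ) with hPdef
  have hP : P * P = P := by
    rw [hPdef, smul_mul_smul_comm]
    have : (1 + σ) * (1 + σ) = (2 : k) • (1 + σ) := by
      rw [mul_add, add_mul, add_mul, hσ, two_smul]; simp; abel
    rw [this, smul_smul, mul_assoc, inv_mul_cancel₀ h2, mul_one]
  have hσP : σ = (2 : k) • P - 1 := by
    rw [hPdef, smul_smul, mul_inv_cancel₀ h2, one_smul]; abel
  have hr := exists_nat_trace_of_mul_self hP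
  set r := Module.finrank k (LinearMap.range P) with hrdef
  have hrd : r ≤ Module.finrank k V := Submodule.finrank_le _
  -- With r the multiplicity of the eigenvalue 1 and d = dim V, the relation 2r − d = d z with 0 ≤ r
  -- ≤ d and z ≠ 0 leaves only r = 0 or r = d.
  have htr : (2 * r - Module.finrank k V : ℤ) = Module.finrank k V * z := by
    have : LinearMap.trace k V σ = 2 * r - Module.finrank k V := by
      conv_lhs => rw [hσP]
      rw [map_sub, map_smul, hr, LinearMap.trace_one, smul_eq_mul]
    rw [this] at hz
    exact_mod_cast hz
  have hz1 : z ≠ 0 := by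
    rintro rfl
    exact hz0 (by rw [hz]; simp)
  rcases Nat.eq_zero_or_pos r with h0 | hpos
  · right
    have : P = 0 := by
      rw [← LinearMap.range_eq_bot, ← Submodule.finrank_eq_zero (R := k)]
      exact hrdef ▸ h0
    rw [hσP, this]; simp
  · left
    have hrd' : r = Module.finrank k V := by
      rcases lt_or_gt_of_ne hz1 with hz2 | hz2
      · have : (Module.finrank k V : ℤ) * z ≤ Module.finrank k V * (-1) :=
          mul_le_mul_of_nonneg_left (by omega) (by positivity)
        omega
      · have : (Module.finrank k V : ℤ) * 1 ≤ Module.finrank k V * z :=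
          mul_le_mul_of_nonneg_left (by omega) (by positivity)
        omega
    have htop : LinearMap.range P = ⊤ := Submodule.eq_top_of_finrank_eq (hrdef ▸ hrd')
    have hP1 : P = 1 := by
      ext x
      obtain ⟨y, rfl⟩ := LinearMap.range_eq_top.mp htop x
      exact LinearMap.congr_fun hP y
    rw [hσP, hP1, two_smul]; abel

end Cubic

/-! ### From S⁴ = 1 and Tr S² ≠ 0 to S² = 1 -/

section LarsonRadford

variable {k : Type v} {H : Type u} [Field k] [Ring H] [HopfAlgebra k H] [FiniteDimensional k H]

/-- S² is a coalgebra map, so replacing f by f ∘ S² conjugates `hitR f` by the involution S² and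
leaves its trace unchanged. -/
theorem antipodeSq_regularChar (hsq : antipodeSq k H * antipodeSq k H = 1) :
    antipode k (antipode k (regularChar k H)) = regularChar k H := by
  refine ext_of_forall_dual (k := k) fun f => ?_
  have h1 : f (antipode k (antipode k (regularChar k H))) =
      dualAntipode (dualAntipode f) (regularChar k H) := rfl
  have h2 : hitR (dualAntipode (dualAntipode f)) = antipodeSq k H * (hitR f * antipodeSq k H) := by
    have h3 : antipodeSq k H * hitR (dualAntipode (dualAntipode f)) = hitR f * antipodeSq k H := by
      ext x
      have h4 : comul (R := k) (antipode k (antipode k x)) = ∑ i ∈ (ℛ k x).index,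
          antipode k (antipode k ((ℛ k x).left i)) ⊗ₜ[k]
            antipode k (antipode k ((ℛ k x).right i)) :=
        comul_antipode (x := antipode k x) ⟨(ℛ k x).index, fun i => antipode k ((ℛ k x).right i),
          fun i => antipode k ((ℛ k x).left i), (comul_antipode (ℛ k x)).symm⟩
      rw [Module.End.mul_apply, Module.End.mul_apply, antipodeSq_apply, antipodeSq_apply,
        hitR_apply f, h4, hitR_repr _ (ℛ k x)]
      simp
    rw [← h3, ← mul_assoc, hsq, one_mul]
  rw [h1, apply_regularChar, apply_regularChar, h2, LinearMap.trace_mul_comm, mul_assoc, hsq,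
    mul_one]

/-- The left integral l acts by the rank-one map x ↦ l(x) 1, of trace l(1) = Tr S². -/
theorem traceForm_one_regularChar : traceForm (1 : DualHopf k H) (regularChar k H) =
    LinearMap.trace k H (antipodeSq k H) := by
  have h1 : hitR (traceForm (1 : DualHopf k H)) =
      LinearMap.smulRight (DualHopf.equiv k H (traceForm (1 : DualHopf k H))) 1 := by
    ext x
    simp [(isLeftIntegralForm_traceForm (1 : DualHopf k H)).hitR_eq]
  rw [apply_regularChar, h1, LinearMap.trace_smulRight, traceForm_one_one]

theorem antipode_antipode_of_trace_ne_zero [CharZero k]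
    (hsq : antipodeSq k H * antipodeSq k H = 1)
    (hne : LinearMap.trace k H (antipodeSq k H) ≠ 0) (x : H) :
    antipode k (antipode k x) = x := by
  have hd : (Module.finrank k H : k) ≠ 0 := by
    intro h0
    have h1 : Module.finrank k H = 0 := by exact_mod_cast h0
    have := Module.finrank_zero_iff.mp h1
    refine hne ?_
    rw [Subsingleton.elim (antipodeSq k H) 0, map_zero]
  set d : k := (Module.finrank k H : k) with hddef
  set c := regularChar k H with hcdef
  have hcc : c * c = d • c := regularChar_mul_self
  have hSc : antipode k (antipode k c) = c := antipodeSq_regularChar hsq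
  have hS4 : ∀ y : H, antipode k (antipode k (antipode k (antipode k y))) = y :=
    fun y => LinearMap.congr_fun hsq y
  -- From c² = d c, S² c = c and S⁴ = 1 one gets M³ = M. Its trace is l(c)/d = Tr(S²)/d, which is
  -- therefore an integer.
  set M : Module.End k H := d⁻¹ • (LinearMap.mulLeft k c * antipodeSq k H) with hMdef
  have hM : M * M * M = M := by
    have hA : ∀ y, M y = d⁻¹ • (c * antipode k (antipode k y)) := fun y => rfl
    ext y
    simp only [Module.End.mul_apply, hA, map_smul, antipode_mul_antidistrib, hSc, mul_smul_comm,
      ← mul_assoc, hcc, smul_mul_assoc, smul_smul, hS4]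
    congr 1
    field_simp
  obtain ⟨z, hz⟩ := exists_int_trace_of_cube hM
  have hz' : LinearMap.trace k H (antipodeSq k H) = Module.finrank k H * z := by
    rw [← hz, hMdef, map_smul, ← hddef, smul_eq_mul, mul_inv_cancel_left₀ hd,
      ← traceForm_one_regularChar, traceForm_apply, hitR_one, one_mul]
  rcases eq_one_or_eq_neg_one_of_trace hsq hz' hne with h | h
  · exact LinearMap.congr_fun h x
  · have h1 := LinearMap.congr_fun h 1
    have h2 := congrArg (counit (R := k)) h1
    simp only [antipodeSq_apply, antipode_one, LinearMap.neg_apply, Module.End.one_apply, map_neg,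
      Bialgebra.counit_one] at h2
    have : (2 : k) = 0 := by linear_combination h2
    exact absurd this two_ne_zero

end LarsonRadford

/-! ### The Larson–Radford theorem over ℂ -/

section Complex

variable {H : Type u} [Ring H] [HopfAlgebra ℂ H] [FiniteDimensional ℂ H] [IsSemisimpleRing H]

theorem trace_antipodeSq_ne_zero : LinearMap.trace ℂ H (antipodeSq ℂ H) ≠ 0 := by
  obtain ⟨t, ht⟩ := exists_isNormalizedIntegral ℂ H
  obtain ⟨N, hN, hpow⟩ := ht.exists_antipodeSq_pow_eq_one
  obtain ⟨n, d, hd, ⟨e⟩⟩ := IsSemisimpleRing.exists_algEquiv_pi_matrix_of_isAlgClosed ℂ H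
  let e' := e.toLinearEquiv
  rw [← LinearMap.trace_conj' _ e']
  have he' : ∀ x, e' x = e x := fun _ => rfl
  have hes : ∀ x, e'.symm x = e.symm x := fun _ => rfl
  -- S² is transported to the Wedderburn blocks. The central element is the image of the two-sided
  -- integral t, on which the form takes the value 1.
  refine trace_ne_zero_of_nakayama (N := N)
    (φ := DualHopf.equiv ℂ H (traceForm (1 : DualHopf ℂ H)) ∘ₗ e'.symm.toLinearMap) (c := e t)
    hN ?_ ?_ ?_ ?_ ?_
  · have h1 : ∀ m, e'.conj (antipodeSq ℂ H) ^ m = e'.conj (antipodeSq ℂ H ^ m) := by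
      intro m
      induction m with
      | zero => ext x; simp [LinearEquiv.conj_apply]
      | succ m ih =>
        rw [pow_succ, ih, pow_succ]
        ext x
        simp [LinearEquiv.conj_apply]
    rw [h1, hpow]
    ext x
    simp [LinearEquiv.conj_apply]
  · intro j x
    simp only [LinearMap.comp_apply, LinearEquiv.coe_coe, hes, map_mul, LinearEquiv.conj_apply, he',
      AlgEquiv.symm_apply_apply, antipodeSq_apply]
    exact traceForm_one_nakayama _ _
  · intro y hy
    rw [← e.apply_symm_apply y]
    rw [ht.eq_zero_of_traceForm (y := e.symm y), map_zero]
    intro x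
    have := hy (e x)
    simpa [hes] using this
  · intro x
    rw [← e.apply_symm_apply x, ← map_mul, ← map_mul, ht.mul_left, ht.mul_right]
  · simp only [LinearMap.comp_apply, LinearEquiv.coe_coe, hes, AlgEquiv.symm_apply_apply,
      ht.traceForm_one_apply]
    exact one_ne_zero

/-- The Larson–Radford theorem: the antipode of a semisimple Hopf algebra is an involution. -/
theorem antipode_antipode_of_isSemisimpleRing (x : H) : antipode ℂ (antipode ℂ x) = x := by
  obtain ⟨t, ht⟩ := exists_isNormalizedIntegral ℂ H
  exact antipode_antipode_of_trace_ne_zero (ht.antipodeSq_sq_eq_one trace_antipodeSq_ne_zero)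
    trace_antipodeSq_ne_zero x

end Complex

/-! ### Annihilators: ideals of H and subcoalgebras of H* -/

section Annihilators

variable {k : Type v} {H : Type u} [Field k] [Ring H] [HopfAlgebra k H]

/-- The functionals vanishing on a subspace. -/
def annDual (I : Submodule k H) : Submodule k (DualHopf k H) :=
  I.dualAnnihilator.comap (DualHopf.equiv k H).toLinearMap

/-- The common zeros of a space of functionals. -/
def coAnn (B : Submodule k (DualHopf k H)) : Submodule k H :=
  (B.map (DualHopf.equiv k H).toLinearMap).dualCoannihilator

theorem mem_annDual {I : Submodule k H} {f : DualHopf k H} :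
    f ∈ annDual I ↔ ∀ x ∈ I, f x = 0 := by
  simp [annDual, Submodule.mem_dualAnnihilator]

theorem mem_coAnn {B : Submodule k (DualHopf k H)} {x : H} :
    x ∈ coAnn B ↔ ∀ f ∈ B, f x = 0 := by
  rw [coAnn, Submodule.mem_dualCoannihilator]
  refine ⟨fun h f hf => h _ (Submodule.mem_map_of_mem hf), fun h φ hφ => ?_⟩
  obtain ⟨f, hf, rfl⟩ := hφ
  exact h f hf

theorem coAnn_annDual (I : Submodule k H) : coAnn (annDual I) = I := by
  rw [coAnn, annDual, Submodule.map_comap_eq_of_surjective (DualHopf.equiv k H).surjective,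
    Subspace.dualAnnihilator_dualCoannihilator_eq]

theorem annDual_coAnn [FiniteDimensional k H] (B : Submodule k (DualHopf k H)) :
    annDual (coAnn B) = B := by
  rw [coAnn, annDual, Subspace.dualCoannihilator_dualAnnihilator_eq,
    Submodule.comap_map_eq_of_injective (DualHopf.equiv k H).injective]

theorem coAnn_antitone {B C : Submodule k (DualHopf k H)} (h : B ≤ C) : coAnn C ≤ coAnn B :=
  fun _ hx => mem_coAnn.mpr fun f hf => mem_coAnn.mp hx f (h hf)

theorem annDual_antitone {I J : Submodule k H} (h : I ≤ J) : annDual J ≤ annDual I :=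
  fun _ hf => mem_annDual.mpr fun x hx => mem_annDual.mp hf x (h hx)

variable (k H) in
/-- The functionals vanishing on the Jacobson radical. -/
def radPerp : Submodule k (DualHopf k H) := annDual ((Ring.jacobson H).restrictScalars k)

theorem mem_radPerp {f : DualHopf k H} : f ∈ radPerp k H ↔ ∀ x ∈ Ring.jacobson H, f x = 0 :=
  mem_annDual

theorem mem_jacobson_iff_radPerp {x : H} :
    x ∈ Ring.jacobson H ↔ ∀ f ∈ radPerp k H, f x = 0 := by
  rw [← mem_coAnn, radPerp, coAnn_annDual]
  rfl

variable [FiniteDimensional k H]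

/-- A functional killing I comes from the finite-dimensional algebra H/I, and so does its coproduct.
-/
theorem isSubcoalgebra_annDual (I : Ideal H) [I.IsTwoSided] :
    IsSubcoalgebra (annDual (I.restrictScalars k)) := by
  intro f hf
  let Q := H ⧸ I
  let π : H →ₐ[k] Q := Ideal.Quotient.mkₐ k I
  let F : Q →ₗ[k] k := (I.restrictScalars k).liftQ (DualHopf.equiv k H f) (mem_annDual.mp hf)
  have hF : ∀ x, F (π x) = f x := fun x => rfl
  have : FiniteDimensional k Q := inferInstanceAs (FiniteDimensional k (H ⧸ I.restrictScalars k))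
  obtain ⟨T, hT⟩ := (TensorProduct.dualDistribEquiv k Q Q).surjective (F ∘ₗ LinearMap.mul' k Q)
  let ρ : Module.Dual k Q →ₗ[k] annDual (I.restrictScalars k) :=
    LinearMap.codRestrict _ ((DualHopf.equiv k H).symm.toLinearMap ∘ₗ
      LinearMap.lcomp k k π.toLinearMap) fun φ => mem_annDual.mpr fun x hx => by
        have : π x = 0 := Ideal.Quotient.eq_zero_iff_mem.mpr hx
        change φ (π x) = 0
        rw [this, map_zero]
  refine ⟨TensorProduct.map ρ ρ T, ?_⟩
  refine pair₂_injective ?_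
  ext x y
  change pair₂ k H _ (x ⊗ₜ y) = pair₂ k H _ (x ⊗ₜ y)
  rw [dual_comul_eq, pair₂_dualComul, ← hF, map_mul]
  have h2 : TensorProduct.dualDistrib k Q Q T (π x ⊗ₜ π y) = F (π x * π y) :=
    LinearMap.congr_fun hT (π x ⊗ₜ π y)
  rw [← h2]
  clear hT h2
  induction T with
  | zero => simp
  | tmul φ ψ => rfl
  | add a b ha hb => simp only [map_add, LinearMap.add_apply, ha, hb]

theorem IsSubcoalgebra.mul_apply_eq_zero {B : Submodule k (DualHopf k H)} (hB : IsSubcoalgebra B)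
    {f : DualHopf k H} (hf : f ∈ B) {x y : H} (h : x ∈ coAnn B ∨ y ∈ coAnn B) : f (x * y) = 0 := by
  obtain ⟨T, hT⟩ := hB f hf
  rw [← pair₂_dualComul, ← dual_comul_eq, ← hT]
  clear hT
  induction T with
  | zero => simp
  | tmul φ ψ =>
    rw [TensorProduct.map_tmul, pair₂_tmul]
    rcases h with h | h
    · simp [mem_coAnn.mp h _ φ.2]
    · simp [mem_coAnn.mp h _ ψ.2]
  | add a b ha hb => simp only [map_add, LinearMap.add_apply, ha, hb, add_zero]

/-- The two-sided ideal of common zeros of a subcoalgebra of the dual. -/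
def coAnnIdeal (B : Submodule k (DualHopf k H)) (hB : IsSubcoalgebra B) : Ideal H where
  carrier := coAnn B
  add_mem' := (coAnn B).add_mem
  zero_mem' := (coAnn B).zero_mem
  smul_mem' x _ hy := mem_coAnn.mpr fun _ hf => hB.mul_apply_eq_zero hf (x := x) (Or.inr hy)

theorem mem_coAnnIdeal {B : Submodule k (DualHopf k H)} {hB : IsSubcoalgebra B} {x : H} :
    x ∈ coAnnIdeal B hB ↔ ∀ f ∈ B, f x = 0 := mem_coAnn

instance isTwoSided_coAnnIdeal (B : Submodule k (DualHopf k H)) (hB : IsSubcoalgebra B) :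
    (coAnnIdeal B hB).IsTwoSided :=
  ⟨fun y hx => mem_coAnn.mpr fun _ hf => hB.mul_apply_eq_zero hf (y := y) (Or.inl hx)⟩

/-- For a simple subcoalgebra D with ideal of zeros P, D ∩ J^⊥ is the annihilator of P + J, hence D
or 0. In the second case P + J = H; as J is nilpotent, P contains a unit, so D = 0, which is
excluded. -/
theorem corad_le_radPerp : corad k (DualHopf k H) ≤ radPerp k H := by
  refine sSup_le ?_
  rintro D ⟨hD, hD0, hDmin⟩
  let P := coAnnIdeal D hD
  have hE : D ⊓ radPerp k H = annDual ((P ⊔ Ring.jacobson H).restrictScalars k) := by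
    conv_lhs => rw [← annDual_coAnn D]
    ext f
    simp only [Submodule.mem_inf, mem_radPerp, mem_annDual, Submodule.restrictScalars_mem]
    constructor
    · rintro ⟨h1, h2⟩ x hx
      obtain ⟨p, hp, j, hj, rfl⟩ := Submodule.mem_sup.mp hx
      rw [map_add, h1 p hp, h2 j hj, add_zero]
    · intro h
      exact ⟨fun x hx => h x (Submodule.mem_sup_left hx),
        fun x hx => h x (Submodule.mem_sup_right hx)⟩
  have hEsub : IsSubcoalgebra (D ⊓ radPerp k H) := by
    have : (P ⊔ Ring.jacobson H).IsTwoSided := ⟨fun y hx => by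
      obtain ⟨p, hp, j, hj, rfl⟩ := Submodule.mem_sup.mp hx
      rw [add_mul]
      exact add_mem (Submodule.mem_sup_left (Ideal.mul_mem_right y _ hp))
        (Submodule.mem_sup_right (Ideal.mul_mem_right y _ hj))⟩
    rw [hE]
    exact isSubcoalgebra_annDual _
  rcases hDmin _ hEsub inf_le_left with h | h
  · exfalso
    have h1 : (P ⊔ Ring.jacobson H).restrictScalars k = ⊤ := by
      rw [← coAnn_annDual ((P ⊔ Ring.jacobson H).restrictScalars k), ← hE, h]
      exact eq_top_iff.mpr fun x _ => mem_coAnn.mpr fun f hf => by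
        rw [(Submodule.mem_bot k).mp hf]; simp
    have h2 : (1 : H) ∈ P ⊔ Ring.jacobson H := by
      rw [← Submodule.restrictScalars_mem k, h1]; trivial
    obtain ⟨p, hp, j, hj, hpj⟩ := Submodule.mem_sup.mp h2
    have h3 : IsUnit p := by
      rw [show p = 1 - j by rw [← hpj]; abel]
      exact (isNilpotent_of_mem_jacobson k hj).isUnit_one_sub
    have h4 : P = ⊤ := Ideal.eq_top_of_isUnit_mem _ hp h3
    refine hD0 (eq_bot_iff.mpr fun f hf => ?_)
    rw [Submodule.mem_bot]
    ext x
    have : x ∈ P := by rw [h4]; trivial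
    simpa using mem_coAnnIdeal.mp this f hf
  · exact inf_eq_left.mp h

end Annihilators

/-! ### The coradical of H* as the annihilator of the radical -/

section CoradicalComplex

variable {H : Type u} [Ring H] [HopfAlgebra ℂ H] [FiniteDimensional ℂ H]

theorem isSimpleSubcoalgebra_annDual_ker {R : Type*} [Ring R] [IsSimpleRing R]
    (φ : H →+* R) (hφ : Function.Surjective φ) :
    IsSimpleSubcoalgebra (annDual ((RingHom.ker φ).restrictScalars ℂ)) := by
  refine ⟨isSubcoalgebra_annDual _, fun h => ?_, fun E hE hED => ?_⟩
  · have h1 := coAnn_annDual ((RingHom.ker φ).restrictScalars ℂ)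
    rw [h] at h1
    have h2 : (1 : H) ∈ (RingHom.ker φ).restrictScalars ℂ := by
      rw [← h1]
      exact mem_coAnn.mpr fun f hf => by rw [(Submodule.mem_bot ℂ).mp hf]; simp
    have h3 : φ 1 = 0 := h2
    rw [map_one] at h3
    exact one_ne_zero h3
  · have hle : RingHom.ker φ ≤ coAnnIdeal E hE := by
      have := coAnn_antitone hED
      rw [coAnn_annDual] at this
      exact this
    by_cases htop : coAnnIdeal E hE = ⊤
    · left
      refine eq_bot_iff.mpr fun f hf => ?_
      rw [Submodule.mem_bot]
      ext x
      have : x ∈ coAnnIdeal E hE := by rw [htop]; trivial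
      simpa using mem_coAnnIdeal.mp this f hf
    · right
      refine le_antisymm hED ?_
      have : Nontrivial (H ⧸ coAnnIdeal E hE) := Ideal.Quotient.nontrivial_iff.mpr htop
      -- H modulo the zeros of E is a nonzero quotient of the simple ring R, so the quotient map is
      -- injective and E has no more zeros than ker φ.
      let ψ : R →+* H ⧸ coAnnIdeal E hE :=
        RingHom.liftOfSurjective φ hφ ⟨Ideal.Quotient.mk _, fun x hx =>
          Ideal.Quotient.eq_zero_iff_mem.mpr (hle hx)⟩
      have hψ : ∀ x, ψ (φ x) = Ideal.Quotient.mk _ x := fun x =>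
        RingHom.liftOfRightInverse_comp_apply _ _ _ _ _
      have h1 : coAnn E ≤ (RingHom.ker φ).restrictScalars ℂ := by
        intro x hx
        have : ψ (φ x) = 0 := by rw [hψ]; exact Ideal.Quotient.eq_zero_iff_mem.mpr hx
        exact (map_eq_zero_iff ψ ψ.injective).mp this
      have h2 := annDual_antitone h1
      rwa [annDual_coAnn] at h2

/-- The coradical of `H*` is the space of functionals vanishing on the radical of `H`. -/
theorem corad_eq_radPerp : corad ℂ (DualHopf ℂ H) = radPerp ℂ H := by
  refine le_antisymm corad_le_radPerp ?_
  rw [← annDual_coAnn (corad ℂ (DualHopf ℂ H))]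
  refine annDual_antitone fun h hh => ?_
  by_contra hJ
  have := IsArtinianRing.of_finite ℂ H
  have : FiniteDimensional ℂ (H ⧸ Ring.jacobson H) :=
    inferInstanceAs (FiniteDimensional ℂ (H ⧸ (Ring.jacobson H).restrictScalars ℂ))
  obtain ⟨n, d, hd, ⟨e⟩⟩ := IsSemisimpleRing.exists_algEquiv_pi_matrix_of_isAlgClosed ℂ
    (H ⧸ Ring.jacobson H)
  have h1 : e (Ideal.Quotient.mk _ h) ≠ 0 := by
    rw [ne_eq, map_eq_zero_iff e e.injective, Ideal.Quotient.eq_zero_iff_mem]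
    exact hJ
  -- An element outside J survives in some matrix block of H/J; the functionals that factor through
  -- that block form a simple subcoalgebra, so they cannot all kill h.
  obtain ⟨i, hi⟩ := Function.ne_iff.mp h1
  let φ : H →+* Matrix (Fin (d i)) (Fin (d i)) ℂ :=
    ((Pi.evalRingHom _ i).comp (e : _ →+* Π i, Matrix (Fin (d i)) (Fin (d i)) ℂ)).comp
      (Ideal.Quotient.mk (Ring.jacobson H))
  have hφ : Function.Surjective φ :=
    ((Function.surjective_eval i).comp e.surjective).comp Ideal.Quotient.mk_surjective
  have h2 : h ∈ coAnn (annDual ((RingHom.ker φ).restrictScalars ℂ)) :=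
    coAnn_antitone (le_sSup (isSimpleSubcoalgebra_annDual_ker φ hφ)) hh
  rw [coAnn_annDual] at h2
  exact hi h2

end CoradicalComplex

/-! ### Right H*-comodules as left H-modules -/

section ComoduleModule

variable {k : Type v} {H : Type u} [Field k] [Ring H] [HopfAlgebra k H]

section Evaluation

variable {V : Type w} {W : Type*} [AddCommGroup V] [Module k V] [AddCommGroup W] [Module k W]

variable (k) in
/-- Evaluation of functionals at an element. -/
def dualEval (h : H) : DualHopf k H →ₗ[k] k :=
  LinearMap.applyₗ h ∘ₗ (DualHopf.equiv k H).toLinearMap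

@[simp] theorem dualEval_apply (h : H) (f : DualHopf k H) : dualEval k h f = f h := rfl

variable (k) in
/-- The contraction `v ⊗ f ↦ f(h) v`. -/
def contract (V : Type w) [AddCommGroup V] [Module k V] (h : H) : V ⊗[k] DualHopf k H →ₗ[k] V :=
  (TensorProduct.rid k V).toLinearMap ∘ₗ (dualEval k h).lTensor V

@[simp] theorem contract_tmul (h : H) (v : V) (f : DualHopf k H) :
    contract k V h (v ⊗ₜ f) = f h • v := by
  simp [contract]

theorem contract_rTensor (h : H) (ρ : V →ₗ[k] W) (t : V ⊗[k] DualHopf k H) :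
    contract k W h (ρ.rTensor _ t) = ρ (contract k V h t) := by
  induction t with
  | zero => simp
  | tmul v f => simp
  | add a b ha hb => simp only [map_add, ha, hb]

theorem contract_add (h g : H) (t : V ⊗[k] DualHopf k H) :
    contract k V (h + g) t = contract k V h t + contract k V g t := by
  induction t with
  | zero => simp
  | tmul v f => simp [add_smul]
  | add a b ha hb => simp only [map_add, ha, hb]; abel

theorem contract_smul (c : k) (h : H) (t : V ⊗[k] DualHopf k H) :
    contract k V (c • h) t = c • contract k V h t := by
  induction t with
  | zero => simp
  | tmul v f => simp [mul_smul]
  | add a b ha hb => simp only [map_add, ha, hb, smul_add]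

variable [FiniteDimensional k H]

theorem contract_mulMiddle {W : Type w} [AddCommGroup W] [Module k W] {ι : Type*} {h : H}
    (r : Coalgebra.Repr k h ι)
    (s : V ⊗[k] DualHopf k H) (t : W ⊗[k] DualHopf k H) :
    contract k (V ⊗[k] W) h (RightComodule.mulMiddle k (DualHopf k H) V W (s ⊗ₜ t)) =
      ∑ i ∈ r.index, contract k V (r.left i) s ⊗ₜ[k] contract k W (r.right i) t := by
  induction s with
  | zero => simp
  | add a b ha hb => simp only [TensorProduct.add_tmul, map_add, ha, hb, Finset.sum_add_distrib]
  | tmul v f =>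
    induction t with
    | zero => simp
    | add a b ha hb => simp only [TensorProduct.tmul_add, map_add, ha, hb, Finset.sum_add_distrib]
    | tmul w g =>
      rw [RightComodule.mulMiddle_tmul, contract_tmul, DualHopf.mul_apply_repr f g r,
        Finset.sum_smul]
      refine Finset.sum_congr rfl fun i _ => ?_
      rw [contract_tmul, contract_tmul, TensorProduct.smul_tmul_smul]

/-- Identifies V ⊗ H* with Hom(H, V): a tensor is recovered from its contractions against a basis.
-/
theorem sum_contract_tmul (t : V ⊗[k] DualHopf k H) :
    ∑ i, contract k V (Module.finBasis k H i) t ⊗ₜ[k]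
      (DualHopf.equiv k H).symm ((Module.finBasis k H).coord i) = t := by
  induction t with
  | zero => simp
  | add a b ha hb =>
    simp only [map_add, TensorProduct.add_tmul, Finset.sum_add_distrib, ha, hb]
  | tmul v f =>
    simp only [contract_tmul, TensorProduct.smul_tmul]
    rw [← TensorProduct.tmul_sum]
    congr 1
    ext x
    rw [map_sum, LinearMap.sum_apply]
    conv_rhs => rw [← (Module.finBasis k H).sum_repr x]
    simp only [map_sum, map_smul, LinearMap.smul_apply, LinearEquiv.apply_symm_apply,
      Module.Basis.coord_apply, smul_eq_mul]
    exact Finset.sum_congr rfl fun _ _ => mul_comm _ _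

theorem contract_ext {s t : V ⊗[k] DualHopf k H}
    (h : ∀ x : H, contract k V x s = contract k V x t) : s = t := by
  rw [← sum_contract_tmul s, ← sum_contract_tmul t]
  simp only [h]

theorem contract_contract_comul (h g : H) (t : V ⊗[k] DualHopf k H) :
    contract k V h (contract k _ g ((TensorProduct.assoc k _ _ _).symm
      ((comul (R := k) (A := DualHopf k H)).lTensor V t))) = contract k V (h * g) t := by
  have h1 : ∀ (v : V) (s : DualHopf k H ⊗[k] DualHopf k H),
      contract k V h (contract k _ g ((TensorProduct.assoc k _ _ _).symm (v ⊗ₜ s))) =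
        pair₂ k H s (h ⊗ₜ g) • v := by
    intro v s
    induction s with
    | zero => simp
    | tmul a b => simp [smul_smul, mul_comm]
    | add a b ha hb =>
      simp only [TensorProduct.tmul_add, map_add, ha, hb, LinearMap.add_apply, add_smul]
  induction t with
  | zero => simp
  | tmul v f => rw [LinearMap.lTensor_tmul, h1, dual_comul_eq, pair₂_dualComul, contract_tmul]
  | add a b ha hb => simp only [map_add, ha, hb]

theorem contract_counit (t : V ⊗[k] DualHopf k H) : TensorProduct.rid k V
    ((counit (R := k) (A := DualHopf k H)).lTensor V t) = contract k V 1 t := by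
  induction t with
  | zero => simp
  | tmul v f => simp [dual_counit_eq]
  | add a b ha hb => simp only [map_add, ha, hb]

/-- Contracting both sides with elements of H loses nothing in finite dimension, and Δ on H* is dual
to the product of H; coassociativity becomes the action law h(g v) = (h g) v. -/
theorem coassoc_iff (ρ : V →ₗ[k] V ⊗[k] DualHopf k H) (v : V) :
    TensorProduct.assoc k V _ _ (ρ.rTensor _ (ρ v)) =
      (comul (R := k) (A := DualHopf k H)).lTensor V (ρ v) ↔
    ∀ h g, contract k V h (ρ (contract k V g (ρ v))) = contract k V (h * g) (ρ v) := by
  rw [← LinearEquiv.eq_symm_apply]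
  constructor
  · intro hv h g
    rw [← contract_contract_comul, ← hv, contract_rTensor]
  · intro hv
    refine contract_ext fun g => contract_ext fun h => ?_
    rw [contract_contract_comul, contract_rTensor, hv]

end Evaluation

variable {V W : Type w} [AddCommGroup V] [Module k V] [AddCommGroup W] [Module k W]

section Diagonal

variable [Module H V] [IsScalarTower k H V] [Module H W] [IsScalarTower k H W]

theorem isCompl_restrictScalars_iff {U U' : Submodule H V} :
    IsCompl (U.restrictScalars k) (U'.restrictScalars k) ↔ IsCompl U U' := by
  rw [isCompl_iff, isCompl_iff, Submodule.disjoint_def, Submodule.disjoint_def,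
    codisjoint_iff, codisjoint_iff]
  refine and_congr Iff.rfl ?_
  rw [← Submodule.restrictScalars_sup, Submodule.restrictScalars_eq_top_iff]

theorem diagonalAction_tmul {ι : Type*} {h : H} (r : Coalgebra.Repr k h ι) (v : V) (w : W) :
    diagonalAction k H V W h (v ⊗ₜ w) = ∑ i ∈ r.index, (r.left i • v) ⊗ₜ[k] (r.right i • w) := by
  change Module.endTensorEndAlgHom (Algebra.TensorProduct.map (Algebra.lsmul k k V)
    (Algebra.lsmul k k W) (comul (R := k) h)) (v ⊗ₜ w) = _
  rw [← r.eq]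
  simp [Module.endTensorEndAlgHom_apply]

theorem isScalarTower_tensorModule : @IsScalarTower k H (V ⊗[k] W) _
    (tensorModule k H V W).toSMul _ := by
  refine @IsScalarTower.mk _ _ _ _ (_) _ fun c h t => ?_
  change diagonalAction k H V W (c • h) t = c • diagonalAction k H V W h t
  rw [map_smul]
  rfl

end Diagonal

variable [FiniteDimensional k H]

/-- The action of `H` on a right `H*`-comodule. -/
def comoduleAction (M : RightComodule k (DualHopf k H) V) : H →ₐ[k] Module.End k V :=
  AlgHom.ofLinearMap
    { toFun h := contract k V h ∘ₗ M.coact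
      map_add' h g := by ext v; exact contract_add h g _
      map_smul' c h := by ext v; exact contract_smul c h _ }
    (by ext v; exact (contract_counit _).symm.trans (M.counit v))
    (fun h g => by ext v; exact ((coassoc_iff M.coact v).mp (M.coassoc v) h g).symm)

/-- A comodule structure over `H*` and an `H`-module structure that correspond to each other. -/
def IsCompatible (M : RightComodule k (DualHopf k H) V) [Module H V] : Prop :=
  ∀ (h : H) (v : V), h • v = contract k V h (M.coact v)

section OfModule

variable [Module H V] [IsScalarTower k H V]

variable (k H V) in
/-- The coaction of `H*` on an `H`-module. -/
def moduleCoact : V →ₗ[k] V ⊗[k] DualHopf k H :=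
  ∑ i, (TensorProduct.mk k V (DualHopf k H)).flip
    ((DualHopf.equiv k H).symm ((Module.finBasis k H).coord i)) ∘ₗ
      Algebra.lsmul k k V (Module.finBasis k H i)

theorem contract_moduleCoact (h : H) (v : V) : contract k V h (moduleCoact k H V v) = h • v := by
  rw [moduleCoact, LinearMap.sum_apply, map_sum]
  conv_rhs => rw [← (Module.finBasis k H).sum_repr h, Finset.sum_smul]
  refine Finset.sum_congr rfl fun i _ => ?_
  simp

variable (k H V) in
/-- The right `H*`-comodule attached to an `H`-module. -/
def moduleComodule : RightComodule k (DualHopf k H) V where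
  coact := moduleCoact k H V
  coassoc v := (coassoc_iff _ v).mpr fun h g => by
    simp only [contract_moduleCoact, mul_smul]
  counit v := by rw [contract_counit, contract_moduleCoact, one_smul]

theorem isCompatible_moduleComodule : IsCompatible (moduleComodule k H V) :=
  fun h v => (contract_moduleCoact h v).symm

end OfModule

theorem IsCompatible.isSubcomodule_iff {M : RightComodule k (DualHopf k H) V} [Module H V]
    (hM : IsCompatible M) (U : Submodule k V) :
    M.IsSubcomodule U ↔ ∀ (h : H), ∀ u ∈ U, h • u ∈ U := by
  constructor
  · intro hU h u hu
    obtain ⟨t, ht⟩ := hU u hu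
    rw [hM, ← ht, contract_rTensor]
    exact (contract k U h t).2
  · intro hU u hu
    rw [← sum_contract_tmul (M.coact u)]
    refine Submodule.sum_mem _ fun i _ => ?_
    refine ⟨(⟨contract k V (Module.finBasis k H i) (M.coact u), ?_⟩ : U) ⊗ₜ _, rfl⟩
    rw [← hM]
    exact hU _ _ hu

variable [Module H V] [IsScalarTower k H V]

theorem IsCompatible.isSimple_iff {M : RightComodule k (DualHopf k H) V} (hM : IsCompatible M) :
    M.IsSimple ↔ IsSimpleModule H V := by
  constructor
  · rintro ⟨hnt, h⟩
    rw [isSimpleModule_iff]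
    refine { (inferInstance : Nontrivial (Submodule H V)) with eq_bot_or_eq_top := fun U => ?_ }
    have := h (U.restrictScalars k) ((hM.isSubcomodule_iff _).mpr fun h u hu => U.smul_mem h hu)
    simpa using this
  · intro hs
    refine ⟨IsSimpleModule.nontrivial H V, fun U hU => ?_⟩
    let U' : Submodule H V :=
      { U with smul_mem' := fun h u hu => (hM.isSubcomodule_iff U).mp hU h u hu }
    have hU' : U'.restrictScalars k = U := rfl
    rcases eq_bot_or_eq_top U' with h | h
    · left; rw [← hU', h]; rfl
    · right; rw [← hU', h]; rfl

theorem IsCompatible.isSemisimple_iff {M : RightComodule k (DualHopf k H) V}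
    (hM : IsCompatible M) : M.IsSemisimple ↔ IsSemisimpleModule H V := by
  constructor
  · intro h
    rw [isSemisimpleModule_iff]
    refine ⟨fun U => ?_⟩
    obtain ⟨U', hU', hc⟩ := h (U.restrictScalars k)
      ((hM.isSubcomodule_iff _).mpr fun h u hu => U.smul_mem h hu)
    let U'' : Submodule H V :=
      { U' with smul_mem' := fun h u hu => (hM.isSubcomodule_iff U').mp hU' h u hu }
    exact ⟨U'', (isCompl_restrictScalars_iff (k := k)).mp hc⟩
  · intro hs U hU
    let U' : Submodule H V :=
      { U with smul_mem' := fun h u hu => (hM.isSubcomodule_iff U).mp hU h u hu }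
    obtain ⟨U'', hc⟩ := exists_isCompl U'
    exact ⟨U''.restrictScalars k,
      (hM.isSubcomodule_iff _).mpr fun h u hu => U''.smul_mem h hu,
      (isCompl_restrictScalars_iff (k := k)).mpr hc⟩

variable [Module H W] [IsScalarTower k H W]

/-- The product of H* is dual to Δ on H, so the tensor coaction contracts to the diagonal action. -/
theorem IsCompatible.tensor {M : RightComodule k (DualHopf k H) V}
    {N : RightComodule k (DualHopf k H) W} (hM : IsCompatible M) (hN : IsCompatible N) :
    @IsCompatible k H _ _ _ (V ⊗[k] W) _ _ _ (M.tensor N) (tensorModule k H V W) := by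
  intro h t
  change diagonalAction k H V W h t =
    contract k (V ⊗[k] W) h (RightComodule.tensorCoact M N t)
  induction t with
  | zero => simp
  | add a b ha hb => simp only [map_add, ha, hb]
  | tmul v w =>
    rw [diagonalAction_tmul (ℛ k h), RightComodule.tensorCoact_tmul, contract_mulMiddle (ℛ k h)]
    simp only [hM _ _, hN _ _]

end ComoduleModule

/-- `H` has the Chevalley property if and only if its category of right `H*`-comodules does. -/
theorem hasChevalleyProperty_iff_comodules {k : Type v} {H : Type u} [Field k] [Ring H]
    [HopfAlgebra k H] [FiniteDimensional k H] :
    HasChevalleyProperty.{u, v, w} k H ↔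
      ComodulesHaveChevalleyProperty.{max u v, v, w} k (DualHopf k H) := by
  constructor
  · intro hH V W _ _ _ _ M N hMs hNs
    let _ : Module H V := Module.compHom V (comoduleAction M).toRingHom
    let _ : Module H W := Module.compHom W (comoduleAction N).toRingHom
    have hV : ∀ (h : H) (v : V), h • v = comoduleAction M h v := fun _ _ => rfl
    have hW : ∀ (h : H) (v : W), h • v = comoduleAction N h v := fun _ _ => rfl
    have : IsScalarTower k H V := ⟨fun c h v => by rw [hV, hV, map_smul]; rfl⟩
    have : IsScalarTower k H W := ⟨fun c h v => by rw [hW, hW, map_smul]; rfl⟩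
    have hM : IsCompatible M := fun _ _ => rfl
    have hN : IsCompatible N := fun _ _ => rfl
    have hss := hH V W (hM.isSimple_iff.mp hMs) (hN.isSimple_iff.mp hNs)
    exact (@IsCompatible.isSemisimple_iff k H _ _ _ (V ⊗[k] W) _ _ _ (tensorModule k H V W)
      isScalarTower_tensorModule _ (hM.tensor hN)).mpr hss
  · intro hA V W _ _ _ _ _ _ _ _ hVs hWs
    have hM := isCompatible_moduleComodule (k := k) (H := H) (V := V)
    have hN := isCompatible_moduleComodule (k := k) (H := H) (V := W)
    have hss := hA V W _ _ (hM.isSimple_iff.mpr hVs) (hN.isSimple_iff.mpr hWs)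
    exact (@IsCompatible.isSemisimple_iff k H _ _ _ (V ⊗[k] W) _ _ _ (tensorModule k H V W)
      isScalarTower_tensorModule _ (hM.tensor hN)).mp hss

/-! ### Hopf subalgebras of H* and Hopf ideals of H -/

section HopfIdeals

variable {k : Type v} {H : Type u} [Field k] [Ring H] [HopfAlgebra k H]

/-- The subalgebra generated by a subcoalgebra stable under the antipode is a Hopf subalgebra. -/
theorem isHopfSubalgebra_adjoin {D : Submodule k H} (hD : IsSubcoalgebra D)
    (hS : ∀ x ∈ D, antipode k x ∈ D) :
    IsHopfSubalgebra (Subalgebra.toSubmodule (Algebra.adjoin k (D : Set H))) := by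
  set B := Algebra.adjoin k (D : Set H) with hB
  refine ⟨B.one_mem, fun x hx y hy => B.mul_mem hx hy, fun x hx => ?_, fun x hx => ?_⟩
  · have hle : B ≤ ((Algebra.TensorProduct.map B.val B.val).range).comap
        (Bialgebra.comulAlgHom k H) := by
      refine Algebra.adjoin_le fun y hy => ?_
      obtain ⟨t, ht⟩ := hD y hy
      let ι : D →ₗ[k] B := LinearMap.codRestrict (Subalgebra.toSubmodule B) D.subtype
        fun z => Algebra.subset_adjoin z.2
      refine ⟨TensorProduct.map ι ι t, ?_⟩
      change TensorProduct.map B.val.toLinearMap B.val.toLinearMap _ = comul y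
      rw [← ht, ← LinearMap.comp_apply, ← TensorProduct.map_comp]
      rfl
    obtain ⟨t, ht⟩ := hle hx
    exact ⟨t, ht⟩
  · change antipode k x ∈ B
    change x ∈ B at hx
    rw [hB] at hx
    induction hx using Algebra.adjoin_induction with
    | mem y hy => exact Algebra.subset_adjoin (hS y hy)
    | algebraMap r =>
      rw [Algebra.algebraMap_eq_smul_one, map_smul, antipode_one]
      exact B.smul_mem B.one_mem r
    | add y z _ _ hy hz => rw [map_add]; exact B.add_mem hy hz
    | mul y z _ _ hy hz => rw [antipode_mul_antidistrib]; exact B.mul_mem hz hy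

theorem antipode_antipode_of_mem_adjoin {D : Submodule k H}
    (h : ∀ x ∈ D, antipode k (antipode k x) = x) {x : H} (hx : x ∈ Algebra.adjoin k (D : Set H)) :
    antipode k (antipode k x) = x := by
  induction hx using Algebra.adjoin_induction with
  | mem y hy => exact h y hy
  | algebraMap r => simp only [Algebra.algebraMap_eq_smul_one, map_smul, antipode_one]
  | add y z _ _ hy hz => rw [map_add, map_add, hy, hz]
  | mul y z _ _ hy hz => rw [antipode_mul_antidistrib, antipode_mul_antidistrib, hy, hz]

theorem quotientIsHopfAlgebra_of_isHopfIdeal (I : Ideal H) [I.IsTwoSided] [I.IsHopfIdeal k] :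
    QuotientIsHopfAlgebra k I :=
  ⟨inferInstance, Bialgebra.Quotient.mkBialgHom I, fun _ => rfl, fun _ => rfl⟩

variable [FiniteDimensional k H]

theorem dual_antipode_apply (f : DualHopf k H) (x : H) : antipode k f x = f (antipode k x) := rfl

/-- The common zeros of a Hopf subalgebra of `H*` form a Hopf ideal of `H`. -/
theorem IsHopfSubalgebra.isHopfIdeal {B : Submodule k (DualHopf k H)} (hB : IsHopfSubalgebra B) :
    (coAnnIdeal B hB.isSubcoalgebra).IsHopfIdeal k := by
  set I := coAnnIdeal B hB.isSubcoalgebra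
  have hlift (φ : Module.Dual k (H ⧸ I.restrictScalars k)) :
      (DualHopf.equiv k H).symm (φ ∘ₗ (I.restrictScalars k).mkQ) ∈ B := by
    rw [← annDual_coAnn B]
    refine mem_annDual.mpr fun x hx => ?_
    change φ ((I.restrictScalars k).mkQ x) = 0
    rw [Submodule.mkQ_apply, (Submodule.Quotient.mk_eq_zero (I.restrictScalars k)).mpr hx, map_zero]
  exact
    { counit_eq_zero := fun x hx => mem_coAnn.mp hx 1 hB.one_mem
      map_mkQ_comul_eq_zero := fun x hx => by
        refine tensor_ext_of_forall_dual fun φ ψ => ?_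
        -- Functionals φ, ψ on the quotient lift to elements of B, and their product again lies in
        -- B; so Δ(x) pairs to zero with φ ⊗ ψ, which is the coideal condition modulo I.
        have h := mem_coAnn.mp hx _ (hB.mul_mem _ (hlift φ) _ (hlift ψ))
        rw [dualMul_eq_dualDistrib] at h
        rw [map_zero, ← h]
        generalize comul (R := k) x = t
        induction t with
        | zero => simp
        | tmul a b => rfl
        | add a b ha hb => simp only [map_add, ha, hb]
      antipode_mem := fun x hx => mem_coAnn.mpr fun f hf =>
        mem_coAnn.mp hx _ (hB.antipode_mem f hf) }

theorem coAnnIdeal_eq_jacobson {B : Submodule k (DualHopf k H)} {hB : IsSubcoalgebra B}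
    (h : radPerp k H ≤ B) (hS : Ring.jacobson H ≤ coAnnIdeal B hB) :
    coAnnIdeal B hB = Ring.jacobson H :=
  le_antisymm (fun _ hx => (mem_jacobson_iff_radPerp (k := k)).mpr fun f hf =>
    mem_coAnnIdeal.mp hx f (h hf)) hS

variable (k H) in
theorem one_mem_radPerp : (1 : DualHopf k H) ∈ radPerp k H :=
  mem_radPerp.mpr fun x hx => by
    obtain ⟨n, hn⟩ := isNilpotent_of_mem_jacobson k hx
    have := congrArg (counit (R := k)) hn
    rw [Bialgebra.counit_pow, map_zero] at this
    exact eq_zero_of_pow_eq_zero this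

theorem antipode_mem_radPerp {f : DualHopf k H} (hf : f ∈ radPerp k H) :
    antipode k f ∈ radPerp k H :=
  mem_radPerp.mpr fun _ hx => mem_radPerp.mp hf _ (antipode_mem_jacobson (k := k) hx)

theorem isHopfIdeal_jacobson_of_antipode_antipode [CharZero k]
    (h : ∀ f ∈ radPerp k H, antipode k (antipode k f) = f) :
    (Ring.jacobson H).IsHopfIdeal k := by
  have hB := isHopfSubalgebra_adjoin (D := radPerp k H) (isSubcoalgebra_annDual _)
    fun f hf => antipode_mem_radPerp hf
  set B := Subalgebra.toSubmodule (Algebra.adjoin k (radPerp k H : Set (DualHopf k H)))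
  have hI := hB.isHopfIdeal
  set I := coAnnIdeal B hB.isSubcoalgebra with hI'
  -- S² = 1 extends from J^⊥ to B because S² is multiplicative, and descends by duality to H/I.
  have hbot : Ring.jacobson (H ⧸ I) = ⊥ := by
    have : FiniteDimensional k (H ⧸ I) :=
      inferInstanceAs (FiniteDimensional k (H ⧸ I.restrictScalars k))
    refine jacobson_eq_bot_of_antipode_antipode (k := k) fun x => ?_
    obtain ⟨x, rfl⟩ := Ideal.Quotient.mk_surjective x
    rw [HopfAlgebra.Quotient.antipode_mk, HopfAlgebra.Quotient.antipode_mk, Ideal.Quotient.eq]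
    refine mem_coAnnIdeal.mpr fun f hf => ?_
    rw [map_sub, ← dual_antipode_apply, ← dual_antipode_apply,
      antipode_antipode_of_mem_adjoin h hf, sub_self]
  rw [← coAnnIdeal_eq_jacobson (hB := hB.isSubcoalgebra) Algebra.subset_adjoin
    (Ring.jacobson_le_of_eq_bot hbot)]
  exact hI

theorem isHopfIdeal_jacobson_of_isHopfSubalgebra (h : IsHopfSubalgebra (radPerp k H)) :
    (Ring.jacobson H).IsHopfIdeal k := by
  rw [← coAnnIdeal_eq_jacobson (hB := h.isSubcoalgebra) le_rfl
    fun x hx => mem_coAnnIdeal.mpr ((mem_jacobson_iff_radPerp (k := k)).mp hx)]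
  exact h.isHopfIdeal

theorem forall_antipode_antipode_radPerp_iff :
    (∀ f ∈ radPerp k H, antipode k (antipode k f) = f) ↔
      ∀ x : H, Ideal.Quotient.mk (Ring.jacobson H) (antipode k (antipode k x)) =
        Ideal.Quotient.mk (Ring.jacobson H) x := by
  constructor
  · intro h x
    rw [Ideal.Quotient.eq, mem_jacobson_iff_radPerp (k := k)]
    intro f hf
    rw [map_sub, ← dual_antipode_apply, ← dual_antipode_apply, h f hf, sub_self]
  · intro h f hf
    ext x
    rw [dual_antipode_apply, dual_antipode_apply, ← sub_eq_zero, ← map_sub]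
    exact mem_radPerp.mp hf _ (Ideal.Quotient.eq.mp (h x))

end HopfIdeals

/-! ### The Chevalley property and products of matrix coefficients -/

section MatrixCoefficients

variable {k : Type v} {H : Type u} [Field k] [Ring H] [HopfAlgebra k H]

variable (k H) in
/-- The matrix coefficients of the simple modules `H ⧸ m`. -/
def simpleCoefficients : Set (DualHopf k H) :=
  {f | ∃ m : Ideal H, m.IsMaximal ∧ ∃ (φ : Module.Dual k (H ⧸ m)) (v : H ⧸ m),
    ∀ x : H, f x = φ (x • v)}

/-- Dually, an x killed by all coefficients of H/m lies in m (apply x to the class of 1), hence in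
every maximal left ideal. -/
theorem radPerp_le_span_simpleCoefficients [FiniteDimensional k H] :
    radPerp k H ≤ Submodule.span k (simpleCoefficients k H) := by
  rw [← annDual_coAnn (Submodule.span k (simpleCoefficients k H))]
  refine annDual_antitone fun x hx => ?_
  rw [Submodule.restrictScalars_mem, Ring.jacobson_eq_sInf_isMaximal, Submodule.mem_sInf]
  intro m hm
  rw [← Submodule.Quotient.mk_eq_zero, ← Module.forall_dual_apply_eq_zero_iff k]
  intro φ
  let v : H ⧸ m := Submodule.Quotient.mk 1
  have h := mem_coAnn.mp hx ((DualHopf.equiv k H).symm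
    (φ ∘ₗ (LinearMap.toSpanSingleton H (H ⧸ m) v).restrictScalars k))
    (Submodule.subset_span ⟨m, hm, φ, v, fun _ => rfl⟩)
  change φ (x • v) = 0 at h
  rwa [← Submodule.Quotient.mk_smul, smul_eq_mul, mul_one] at h

theorem HasChevalleyProperty.mul_mem_radPerp [FiniteDimensional k H]
    (hH : HasChevalleyProperty.{u, v, u} k H)
    {f g : DualHopf k H} (hf : f ∈ radPerp k H) (hg : g ∈ radPerp k H) : f * g ∈ radPerp k H := by
  refine Submodule.span_induction₂ (p := fun f g _ _ => f * g ∈ radPerp k H) ?_ ?_ ?_ ?_ ?_ ?_ ?_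
    (radPerp_le_span_simpleCoefficients hf) (radPerp_le_span_simpleCoefficients hg)
  · rintro f g ⟨m, hm, φ, v, hf⟩ ⟨n, hn, ψ, w, hg⟩
    refine mem_radPerp.mpr fun x hx => ?_
    have hss := hH (H ⧸ m) (H ⧸ n) (isSimpleModule_iff_isCoatom.mpr hm.out)
      (isSimpleModule_iff_isCoatom.mpr hn.out)
    have h0 := @Module.mem_annihilator H ((H ⧸ m) ⊗[k] (H ⧸ n)) _ _ (tensorModule k H _ _) x
    -- The radical kills the semisimple module H/m ⊗ H/n; pairing x(v ⊗ w) with φ ⊗ ψ gives (f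
    -- g)(x).
    have h1 : diagonalAction k H (H ⧸ m) (H ⧸ n) x (v ⊗ₜ w) = 0 :=
      h0.mp (@IsSemisimpleModule.jacobson_le_annihilator H _ _ _ (tensorModule k H _ _) hss x hx) _
    rw [diagonalAction_tmul (ℛ k x)] at h1
    have h2 := congrArg (TensorProduct.dualDistrib k _ _ (φ ⊗ₜ ψ)) h1
    rw [map_sum, map_zero] at h2
    rw [DualHopf.mul_apply_repr f g (ℛ k x), ← h2]
    exact Finset.sum_congr rfl fun i _ => by
      rw [hf, hg, TensorProduct.dualDistrib_apply]
  · intro g _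
    rw [zero_mul]; exact Submodule.zero_mem _
  · intro g _
    rw [mul_zero]; exact Submodule.zero_mem _
  · intro a b c _ _ _ ha hb
    rw [add_mul]; exact Submodule.add_mem _ ha hb
  · intro a b c _ _ _ ha hb
    rw [mul_add]; exact Submodule.add_mem _ ha hb
  · intro r a b _ _ h
    rw [smul_mul_assoc]; exact Submodule.smul_mem _ _ h
  · intro r a b _ _ h
    rw [mul_smul_comm]; exact Submodule.smul_mem _ _ h

theorem HasChevalleyProperty.isHopfSubalgebra_radPerp [FiniteDimensional k H]
    (hH : HasChevalleyProperty.{u, v, u} k H) : IsHopfSubalgebra (radPerp k H) :=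
  ⟨one_mem_radPerp k H, fun _ hf _ hg => hH.mul_mem_radPerp hf hg, isSubcoalgebra_annDual _,
    fun _ hf => antipode_mem_radPerp hf⟩

end MatrixCoefficients

/-! ### When the radical is a Hopf ideal -/

section ChevalleyOfHopfIdeal

/-- M is a module over the semisimple ring R/J, and its submodules are the same over R. -/
theorem isSemisimpleModule_of_jacobson_smul_eq_zero {R M : Type*} [Ring R] [IsSemiprimaryRing R]
    [AddCommGroup M] [Module R M] (h : ∀ x ∈ Ring.jacobson R, ∀ m : M, x • m = 0) :
    IsSemisimpleModule R M := by
  have hM : Module.IsTorsionBySet R M (Ring.jacobson R) := fun m x => h x x.2 m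
  let _ := hM.module
  exact hM.isSemisimpleModule_iff.mp inferInstance

variable {k : Type v} {H : Type u} [Field k] [Ring H] [HopfAlgebra k H]

variable {V W : Type w} [AddCommGroup V] [Module k V] [Module H V] [IsScalarTower k H V]
  [AddCommGroup W] [Module k W] [Module H W] [IsScalarTower k H W]

theorem diagonalAction_eq_zero {I : Ideal H} [(I.restrictScalars k).IsCoideal]
    (hV : ∀ x ∈ I, ∀ v : V, x • v = 0) (hW : ∀ x ∈ I, ∀ w : W, x • w = 0) {x : H} (hx : x ∈ I)
    (t : V ⊗[k] W) : diagonalAction k H V W x t = 0 := by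
  change Module.endTensorEndAlgHom (Algebra.TensorProduct.map (Algebra.lsmul k k V)
    (Algebra.lsmul k k W) (comul (R := k) x)) t = 0
  -- Δ(x) lies in H ⊗ I + I ⊗ H: the first summand kills W, the second kills V.
  have h := ((Submodule.isCoideal_iff_comul_mem (I.restrictScalars k)).mp inferInstance).2 x hx
  obtain ⟨_, ⟨a, rfl⟩, _, ⟨b, rfl⟩, hab⟩ := Submodule.mem_sup.mp h
  rw [← hab]
  clear hab h
  induction t with
  | zero => simp
  | add s t hs ht => rw [map_add, hs, ht, add_zero]
  | tmul v w =>
    rw [map_add, map_add, LinearMap.add_apply]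
    have ha : Module.endTensorEndAlgHom (R := k) (S := k) (A := k)
        (Algebra.TensorProduct.map (Algebra.lsmul k k V) (Algebra.lsmul k k W)
          ((I.restrictScalars k).subtype.lTensor H a)) (v ⊗ₜ[k] w) = 0 := by
      induction a with
      | zero => simp
      | add a c ha hc => simp only [map_add, LinearMap.add_apply, ha, hc, add_zero]
      | tmul a c => simp [Module.endTensorEndAlgHom_apply, hW c c.2 w]
    have hb : Module.endTensorEndAlgHom (R := k) (S := k) (A := k)
        (Algebra.TensorProduct.map (Algebra.lsmul k k V) (Algebra.lsmul k k W)
          ((I.restrictScalars k).subtype.rTensor H b)) (v ⊗ₜ[k] w) = 0 := by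
      induction b with
      | zero => simp
      | add b c hb hc => simp only [map_add, LinearMap.add_apply, hb, hc, add_zero]
      | tmul c b => simp [Module.endTensorEndAlgHom_apply, hV c c.2 v]
    rw [ha, hb, add_zero]

theorem hasChevalleyProperty_of_isCoideal [FiniteDimensional k H]
    [((Ring.jacobson H).restrictScalars k).IsCoideal] : HasChevalleyProperty.{u, v, w} k H := by
  intro V W _ _ _ _ _ _ _ _ hV hW
  have := IsArtinianRing.of_finite k H
  refine @isSemisimpleModule_of_jacobson_smul_eq_zero _ _ _ _ _ (tensorModule k H V W)
    fun x hx t => ?_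
  exact diagonalAction_eq_zero (I := Ring.jacobson H)
    (fun y hy => Module.mem_annihilator.mp (IsSemisimpleModule.jacobson_le_annihilator H V hy))
    (fun y hy => Module.mem_annihilator.mp (IsSemisimpleModule.jacobson_le_annihilator H W hy))
    hx t

end ChevalleyOfHopfIdeal

theorem mk_antipode_antipode_of_isHopfIdeal {H : Type u} [Ring H] [HopfAlgebra ℂ H]
    [FiniteDimensional ℂ H] [(Ring.jacobson H).IsHopfIdeal ℂ] (x : H) :
    Ideal.Quotient.mk (Ring.jacobson H) (antipode ℂ (antipode ℂ x)) =
      Ideal.Quotient.mk (Ring.jacobson H) x := by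
  have := IsArtinianRing.of_finite ℂ H
  have : FiniteDimensional ℂ (H ⧸ Ring.jacobson H) :=
    inferInstanceAs (FiniteDimensional ℂ (H ⧸ (Ring.jacobson H).restrictScalars ℂ))
  exact antipode_antipode_of_isSemisimpleRing (Ideal.Quotient.mk (Ring.jacobson H) x)

end HopfChevalley

end

theorem proposition4p2 {H : Type u} [Ring H] [HopfAlgebra ℂ H] [FiniteDimensional ℂ H] :
    (∀ x ∈ Ring.jacobson H, HopfAlgebra.antipode ℂ x ∈ Ring.jacobson H) ∧
    List.TFAE
      [HasChevalleyProperty.{u, 0, u} ℂ H,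
        ComodulesHaveChevalleyProperty.{u, 0, u} ℂ (DualHopf ℂ H),
        IsHopfSubalgebra (corad ℂ (DualHopf ℂ H)),
        (Ring.jacobson H).IsHopfIdeal ℂ ∧ QuotientIsHopfAlgebra ℂ (Ring.jacobson H),
        ∀ x : H, Ideal.Quotient.mk (Ring.jacobson H)
            (HopfAlgebra.antipode ℂ (HopfAlgebra.antipode ℂ x)) =
          Ideal.Quotient.mk (Ring.jacobson H) x,
        ∀ f ∈ corad ℂ (DualHopf ℂ H), HopfAlgebra.antipode ℂ (HopfAlgebra.antipode ℂ f) = f] := by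
  refine ⟨fun _ hx => antipode_mem_jacobson hx, ?_⟩
  -- From here on conditions 3 and 6 speak of the annihilator of the radical.
  rw [corad_eq_radPerp]
  tfae_have 1 ↔ 2 := hasChevalleyProperty_iff_comodules
  tfae_have 1 → 3 := fun h => h.isHopfSubalgebra_radPerp
  tfae_have 3 → 4 := fun h => by
    have := isHopfIdeal_jacobson_of_isHopfSubalgebra h
    exact ⟨this, quotientIsHopfAlgebra_of_isHopfIdeal _⟩
  tfae_have 4 → 1 := fun ⟨h, _⟩ => hasChevalleyProperty_of_isCoideal
  tfae_have 4 → 5 := fun ⟨h, _⟩ => mk_antipode_antipode_of_isHopfIdeal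
  tfae_have 6 ↔ 5 := forall_antipode_antipode_radPerp_iff
  tfae_have 6 → 4 := fun h => by
    have := isHopfIdeal_jacobson_of_antipode_antipode h
    exact ⟨this, quotientIsHopfAlgebra_of_isHopfIdeal _⟩
  tfae_finish
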